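/- A locally C*-algebra is a complete Hausdorff complex topological $*$-algebra whose topology is determined by the set $S(A)$ of its continuous C*-seminorms. A Hilbert module over a locally C*-algebra $B$ is a right $B$-module $E$ with a $B$-valued inner product (linear in the second variable) that is complete for the seminorms $x\mapsto p(\langle x,x\rangle)^{1/2}$, $p\in S(B)$; it is full if the inner products $\langle x,y\rangle$ span a dense subspace of $B$. $L_B(E)$ denotes the $*$-algebra of bounded adjointable module maps on $E$, with the topology of the operator seminorms $\tilde p(T)=\inf\{k\ge 0:\ p(\langle Tx,Tx\rangle)^{1/2}\le k\,p(\langle x,x\rangle)^{1/2}\ \forall x\in E\}$, $p\in S(B)$. A representation of $B$ on a Hilbert space $H$ is a continuous $*$-morphism $\varphi:B\to B(H)$. A representation of a Hilbert $B$-module $W$ is a map $\Phi:W\to B(H,K)$ ($H,K$ Hilbert spaces) together with a representation $\varphi$ of $B$ on $H$ such that $\Phi(x)^*\Phi(y)=\varphi(\langle x,y\rangle)$ for all $x,y\in W$. Two representations $\Phi_j:W\to B(H_j,K_j)$, $j=1,2$, are unitarily equivalent if there are unitary operators $U_1:H_1\to H_2$ and $U_2:K_1\to K_2$ with $U_2\Phi_1(w)=\Phi_2(w)U_1$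 for all $w\in W$. The direct sum of representations $\Phi_i:W\to B(H_i,K_i)$, $i\in I$, when it exists, is the representation $\bigoplus_{i}\Phi_i:W\to B(\bigoplus_i H_i,\bigoplus_i K_i)$ given by $w\mapsto\big((h_i)_i\mapsto(\Phi_i(w)h_i)_i\big)$ on the Hilbert space direct sums. Let $A$, $B$ be locally C*-algebras, $V$ a full Hilbert $A$-module, $W$ a full Hilbert $B$-module, $E$ a Hilbert $B$-module and $\Psi:A\to L_B(E)$ a continuous $*$-morphism that is non-degenerate, i.e. the vectors $\Psi(a)x$ span a dense subspace of $E$. Let $V\otimes_\Psi E$ be the interior tensor product, i.e. the Hilbert $B$-module obtained as the Hausdorff completion of the algebraic tensor product for $\langle v\otimes x,w\otimes y\rangle=\langle x,\Psi(\langle v,w\rangle)y\rangle$. For a representation $\Phi:W\to B(H,K)$ with associated representation $\varphi$ of $B$, and a Hilbert $B$-module $F$, let ${}_FH$ be the Hilbert space obtained as the Hausdorff completion of the algebraic tensor product $F\otimes H$ for $\langle x\otimes h,y\otimes k\rangle=\langle h,\varphi(\langle x,y\rangle)k\rangle$. The Rieffel induced representation of $V$ via $E$ is $${}_E^V\Phi:V\to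 B\big({}_EH,\ {}_{V\otimes_\Psi E}H\big),\qquad {}_E^V\Phi(v)(x\otimes h)=v\otimes x\otimes h,$$ with associated representation $a\mapsto(x\otimes h\mapsto\Psi(a)x\otimes h)$ of $A$. **Statement.** Let $\Phi:W\to B(H,K)$ and $\Phi_i:W\to B(H_i,K_i)$, $i\in I$, be representations of $W$ such that the direct sum representation $\bigoplus_{i\in I}\Phi_i:W\to B(\bigoplus_i H_i,\bigoplus_i K_i)$ exists and is unitarily equivalent to $\Phi$. Then the direct sum $\bigoplus_{i\in I}{}_E^V\Phi_i$ of the induced representations exists as a representation of $V$, and ${}_E^V\Phi$ is unitarily equivalent to it. -/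

import Mathlib

set_option linter.unusedSectionVars false

open scoped TensorProduct InnerProductSpace

noncomputable section

namespace LCStar

/-- A continuous C*-seminorm on a topological complex `*`-algebra. The type `CStarSeminorm A` is the
set `S(A)`. -/
structure CStarSeminorm (A : Type*) [NonUnitalRing A] [StarRing A] [Module ℂ A]
    [TopologicalSpace A] extends Seminorm ℂ A where
  mul_le' : ∀ a b : A, toSeminorm (a * b) ≤ toSeminorm a * toSeminorm b
  star_mul_self' : ∀ a : A, toSeminorm (star a * a) = toSeminorm a ^ 2
  continuous' : Continuous toSeminorm

/-- A locally C*-algebra: a complete Hausdorff complex topological `*`-algebra (not necessarily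
unital) whose topology is determined by its continuous C*-seminorms. (Joint continuity of the
product and continuity of the involution and of scalar multiplication follow from the last
field.) -/
class LocallyCStarAlgebra (A : Type*) extends NonUnitalRing A, StarRing A, Module ℂ A,
    IsScalarTower ℂ A A, SMulCommClass ℂ A A, StarModule ℂ A, UniformSpace A,
    IsUniformAddGroup A, CompleteSpace A, T2Space A where
  withSeminorms : WithSeminorms (fun p : CStarSeminorm A => p.toSeminorm)

section Algebra

variable {A : Type*} [LocallyCStarAlgebra A]

instance : FunLike (CStarSeminorm A) A ℝ where
  coe p := p.toSeminorm
  coe_injective p q h := by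
    cases p; cases q
    congr
    exact DFunLike.coe_injective h

/-- Positive elements of a locally C*-algebra. -/
def IsPositive (a : A) : Prop := ∃ b : A, a = star b * b

namespace CStarSeminorm

variable (p : CStarSeminorm A)

lemma coe_toSeminorm (a : A) : p.toSeminorm a = p a := rfl
lemma nonneg (a : A) : 0 ≤ p a := apply_nonneg p.toSeminorm a
lemma zero : p (0 : A) = 0 := map_zero p.toSeminorm
lemma add_le (a b : A) : p (a + b) ≤ p a + p b := map_add_le_add p.toSeminorm a b
lemma sub_le (a b : A) : p (a - b) ≤ p a + p b := map_sub_le_add p.toSeminorm a b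
lemma smul (c : ℂ) (a : A) : p (c • a) = ‖c‖ * p a := map_smul_eq_mul p.toSeminorm c a
lemma mul_le (a b : A) : p (a * b) ≤ p a * p b := p.mul_le' a b
lemma star_mul_self (a : A) : p (star a * a) = p a ^ 2 := p.star_mul_self' a
lemma continuous : Continuous p := p.continuous'
lemma sum_le {ι : Type*} (s : Finset ι) (f : ι → A) : p (∑ i ∈ s, f i) ≤ ∑ i ∈ s, p (f i) :=
  Finset.le_sum_of_subadditive p p.zero.le p.add_le s f

lemma star_le (a : A) : p (star a) ≤ p a := by
  have h1 := p.star_mul_self (star a)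
  have h2 := p.mul_le a (star a)
  rw [star_star] at h1
  by_contra! h
  have h3 := p.nonneg a
  nlinarith

lemma star (a : A) : p (star a) = p a :=
  le_antisymm (p.star_le a) (by simpa using p.star_le (Star.star a))

/-- A copy of `A`, seminormed by `p`. -/
def Pre (_p : CStarSeminorm A) : Type _ := A

instance : NonUnitalRing p.Pre := inferInstanceAs (NonUnitalRing A)
instance : StarRing p.Pre := inferInstanceAs (StarRing A)
instance : Module ℂ p.Pre := inferInstanceAs (Module ℂ A)
instance : IsScalarTower ℂ p.Pre p.Pre := inferInstanceAs (IsScalarTower ℂ A A)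
instance : SMulCommClass ℂ p.Pre p.Pre := inferInstanceAs (SMulCommClass ℂ A A)
instance : StarModule ℂ p.Pre := inferInstanceAs (StarModule ℂ A)

/-- `p` as a seminorm on its copy of `A`. -/
def preSeminorm : AddGroupSeminorm p.Pre := p.toSeminorm.toAddGroupSeminorm

instance : SeminormedAddCommGroup p.Pre := p.preSeminorm.toSeminormedAddCommGroup

instance : NonUnitalSeminormedRing p.Pre :=
  { (inferInstance : NonUnitalRing p.Pre), (inferInstance : SeminormedAddCommGroup p.Pre) with
    norm_mul_le := p.mul_le }

instance : NormedSpace ℂ p.Pre :=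
  { (inferInstance : Module ℂ p.Pre) with
    norm_smul_le := fun c a => (p.smul c a).le }

lemma pre_norm (a : p.Pre) : ‖a‖ = p a := rfl

/-- The C*-algebra `A_p`, as the Hausdorff completion of `A` with respect to `p`. -/
abbrev Quot : Type _ := UniformSpace.Completion p.Pre

open UniformSpace UniformSpace.Completion

instance : Mul p.Quot :=
  ⟨Function.curry <| (isDenseInducing_coe.prodMap isDenseInducing_coe).extend
    ((↑) ∘ Function.uncurry (· * ·))⟩

lemma quot_coe_mul (a b : p.Pre) : ((a * b : p.Pre) : p.Quot) = a * b :=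
  ((isDenseInducing_coe.prodMap isDenseInducing_coe).extend_eq
      ((continuous_coe p.Pre).comp (@continuous_mul p.Pre _ _ _)) (a, b)).symm

instance : ContinuousMul p.Quot where
  continuous_mul := by
    let m := (AddMonoidHom.mul : p.Pre →+ p.Pre →+ p.Pre).compr₂ toCompl
    have : Continuous fun x : p.Pre × p.Pre => m x.1 x.2 :=
      (continuous_coe p.Pre).comp continuous_mul
    have di : IsDenseInducing (toCompl : p.Pre → Completion p.Pre) := isDenseInducing_coe
    exact (di.extend_Z_bilin di this :)

lemma pre_uniformContinuous_star : UniformContinuous (Star.star : p.Pre → p.Pre) := by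
  refine (AddMonoidHomClass.isometry_of_norm (starAddEquiv : p.Pre ≃+ p.Pre) ?_).uniformContinuous
  exact fun a => p.star a

instance : Star p.Quot := ⟨Completion.map Star.star⟩

lemma quot_coe_star (a : p.Pre) : ((Star.star a : p.Pre) : p.Quot) = Star.star (a : p.Quot) :=
  (Completion.map_coe p.pre_uniformContinuous_star a).symm

instance : ContinuousStar p.Quot := ⟨Completion.continuous_map⟩

instance : NonUnitalRing p.Quot :=
  { (inferInstance : AddCommGroup p.Quot), (inferInstance : Mul p.Quot) with
    zero_mul a :=
      Completion.induction_on a (isClosed_eq (by fun_prop) continuous_const)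
        fun a => by rw [← coe_zero, ← quot_coe_mul, zero_mul]
    mul_zero a :=
      Completion.induction_on a (isClosed_eq (by fun_prop) continuous_const)
        fun a => by rw [← coe_zero, ← quot_coe_mul, mul_zero]
    mul_assoc a b c :=
      Completion.induction_on₃ a b c (isClosed_eq (by fun_prop) (by fun_prop))
        fun a b c => by
          rw [← quot_coe_mul, ← quot_coe_mul, ← quot_coe_mul, ← quot_coe_mul, mul_assoc]
    left_distrib a b c :=
      Completion.induction_on₃ a b c (isClosed_eq (by fun_prop) (by fun_prop))
        fun a b c => by
          rw [← coe_add, ← quot_coe_mul, ← quot_coe_mul, ← quot_coe_mul, ← coe_add, mul_add]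
    right_distrib a b c :=
      Completion.induction_on₃ a b c (isClosed_eq (by fun_prop) (by fun_prop))
        fun a b c => by
          rw [← coe_add, ← quot_coe_mul, ← quot_coe_mul, ← quot_coe_mul, ← coe_add, add_mul] }

instance : StarRing p.Quot where
  star_involutive a :=
    Completion.induction_on a (isClosed_eq (by fun_prop) continuous_id)
      fun a => by rw [← quot_coe_star, ← quot_coe_star, star_star]
  star_mul a b :=
    Completion.induction_on₂ a b (isClosed_eq (by fun_prop) (by fun_prop))
      fun a b => by
        rw [← quot_coe_mul, ← quot_coe_star, ← quot_coe_star, ← quot_coe_star, ← quot_coe_mul,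
          star_mul]
  star_add a b :=
    Completion.induction_on₂ a b (isClosed_eq (by fun_prop) (by fun_prop))
      fun a b => by
        rw [← coe_add, ← quot_coe_star, ← quot_coe_star, ← quot_coe_star, ← coe_add, star_add]

instance : NonUnitalNormedRing p.Quot :=
  { (inferInstance : NonUnitalRing p.Quot), (inferInstance : NormedAddCommGroup p.Quot) with
    norm_mul_le := fun a b =>
      Completion.induction_on₂ a b (isClosed_le (by fun_prop) (by fun_prop))
        fun a b => by
          rw [← quot_coe_mul, norm_coe, norm_coe, norm_coe]
          exact norm_mul_le a b }

instance : CStarRing p.Quot where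
  norm_mul_self_le a :=
    Completion.induction_on a (isClosed_le (by fun_prop) (by fun_prop))
      fun a => by
        rw [← quot_coe_star, ← quot_coe_mul, norm_coe, norm_coe, pre_norm, pre_norm, ← sq]
        exact (p.star_mul_self a).ge

instance : IsScalarTower ℂ p.Quot p.Quot where
  smul_assoc c a b :=
    Completion.induction_on₂ a b
      (isClosed_eq ((continuous_fst.const_smul c).mul continuous_snd)
        ((continuous_fst.mul continuous_snd).const_smul c))
      fun a b => by
        rw [smul_eq_mul, smul_eq_mul, ← coe_smul, ← quot_coe_mul, ← quot_coe_mul, ← coe_smul,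
          smul_mul_assoc]

instance : SMulCommClass ℂ p.Quot p.Quot where
  smul_comm c a b :=
    Completion.induction_on₂ a b
      (isClosed_eq ((continuous_fst.mul continuous_snd).const_smul c)
        (continuous_fst.mul (continuous_snd.const_smul c)))
      fun a b => by
        rw [smul_eq_mul, smul_eq_mul, ← coe_smul, ← quot_coe_mul, ← quot_coe_mul, ← coe_smul,
          mul_smul_comm]

instance : StarModule ℂ p.Quot where
  star_smul c a :=
    Completion.induction_on a
      (isClosed_eq (continuous_id.const_smul c).star (Continuous.const_smul continuous_star (Star.star c)))
      fun a => by
        rw [← coe_smul, ← quot_coe_star, ← quot_coe_star, ← coe_smul, star_smul]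

instance : NonUnitalCStarAlgebra p.Quot where

instance : PartialOrder p.Quot := CStarAlgebra.spectralOrder _
instance : StarOrderedRing p.Quot := CStarAlgebra.spectralOrderedRing _

/-- The canonical map `A → A_p`. -/
def π : A →⋆ₙₐ[ℂ] p.Quot where
  toFun a := ((show p.Pre from a) : p.Quot)
  map_smul' c a := coe_smul c (show p.Pre from a)
  map_zero' := coe_zero
  map_add' a b := coe_add (show p.Pre from a) (show p.Pre from b)
  map_mul' a b := p.quot_coe_mul a b
  map_star' a := p.quot_coe_star a

lemma norm_π (a : A) : ‖p.π a‖ = p a := norm_coe (show p.Pre from a)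

lemma denseRange_π : DenseRange p.π := denseRange_coe (α := p.Pre)

lemma continuous_π : Continuous p.π := by
  refine continuous_of_continuousAt_zero p.π ?_
  rw [ContinuousAt, map_zero, tendsto_zero_iff_norm_tendsto_zero]
  simp only [norm_π]
  exact p.continuous.tendsto' 0 0 p.zero

end CStarSeminorm

lemma eq_zero_of_forall (a : A) (h : ∀ p : CStarSeminorm A, p a = 0) : a = 0 := by
  by_contra ha
  obtain ⟨p, hp⟩ := LocallyCStarAlgebra.withSeminorms.separating_of_T1 a ha
  exact hp (h p)

lemma IsPositive.π_nonneg {a : A} (ha : IsPositive a) (p : CStarSeminorm A) : 0 ≤ p.π a := by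
  obtain ⟨b, rfl⟩ := ha
  rw [map_mul, map_star]
  exact star_mul_self_nonneg _

open Polynomial in
lemma exists_sqrt_poly (n : ℕ) :
    ∃ q : ℝ[X], ∀ t ∈ Set.Icc (0 : ℝ) n, |t * q.eval t - √t| ≤ 1 / ((n : ℝ) + 1) := by
  have hε : 0 < 1 / ((n : ℝ) + 1) / 2 := by positivity
  obtain ⟨P, hP⟩ := exists_polynomial_near_of_continuousOn 0 n Real.sqrt
    Real.continuous_sqrt.continuousOn _ hε
  refine ⟨P.divX, fun t ht => ?_⟩
  have h0 := hP 0 ⟨le_rfl, by positivity⟩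
  have h1 := hP t ht
  have h2 : P.eval t = t * P.divX.eval t + P.eval 0 := by
    conv_lhs => rw [← Polynomial.X_mul_divX_add P]
    simp [Polynomial.coeff_zero_eq_eval_zero]
  rw [Real.sqrt_zero, sub_zero] at h0
  rw [h2] at h1
  rw [abs_lt] at h0 h1
  rw [abs_le]
  constructor <;> linarith

open Polynomial Filter Topology in
/-- An element is positive as soon as its image in each `A_p` is. -/
lemma isPositive_of_forall {a : A} (h : ∀ p : CStarSeminorm A, 0 ≤ p.π a) : IsPositive a := by
  choose q hq using exists_sqrt_poly
  let Q : ℕ → ℂ[X] := fun n => X * (q n).map (algebraMap ℝ ℂ)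
  let b : ℕ → A := fun n => (aeval (a : Unitization ℂ A) (Q n)).snd
  have hb : ∀ n, ((b n : A) : Unitization ℂ A) = aeval (a : Unitization ℂ A) (Q n) := by
    intro n
    refine Unitization.ext ?_ ?_
    · simp [Q]
    · simp [b]
  have key : ∀ (p : CStarSeminorm A) (n : ℕ), p a ≤ n →
      ‖p.π (b n) - CFC.sqrt (p.π a)‖ ≤ 1 / ((n : ℝ) + 1) := by
    intro p n hn
    have hpos : (0 : Unitization ℂ p.Quot) ≤ (p.π a : Unitization ℂ p.Quot) :=
      Unitization.inr_nonneg_iff.2 (h p)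
    have e1 : ((p.π (b n) : p.Quot) : Unitization ℂ p.Quot) =
        cfc (fun t : ℝ => t * (q n).eval t) (p.π a : Unitization ℂ p.Quot) := by
      have e2 : ((p.π (b n) : p.Quot) : Unitization ℂ p.Quot) =
          Unitization.starMap p.π (b n : Unitization ℂ A) := by simp
      have e3 : (fun t : ℝ => t * (q n).eval t) = (X * q n).eval := by ext; simp
      have e4 := Polynomial.aeval_algHom_apply
        (Unitization.starMap p.π : Unitization ℂ A →⋆ₐ[ℂ] Unitization ℂ p.Quot).toAlgHom
        (a : Unitization ℂ A) (Q n)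
      rw [e2, hb, e3, cfc_polynomial (X * q n) _ (.of_nonneg hpos)]
      refine e4.symm.trans ?_
      have e5 : Q n = (X * q n).map (algebraMap ℝ ℂ) := by simp [Q]
      rw [e5, Polynomial.aeval_map_algebraMap]
      simp
    have e2 : ((CFC.sqrt (p.π a) : p.Quot) : Unitization ℂ p.Quot) =
        cfc Real.sqrt (p.π a : Unitization ℂ p.Quot) := by
      rw [← Unitization.sqrt_inr, CFC.sqrt_eq_real_sqrt _ hpos, cfcₙ_eq_cfc]
    rw [← Unitization.norm_inr (𝕜 := ℂ), Unitization.inr_sub, e1, e2,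
      ← cfc_sub _ Real.sqrt _ (by fun_prop) (by fun_prop)]
    refine norm_cfc_le (by positivity) fun t ht => hq n t ⟨?_, ?_⟩
    · exact spectrum_nonneg_of_nonneg hpos ht
    · refine (Real.le_norm_self t).trans ((spectrum.norm_le_norm_of_mem ht).trans ?_)
      rw [Unitization.norm_inr, p.norm_π]
      exact hn
  have htends : ∀ p : CStarSeminorm A, Tendsto (fun n => p.π (b n)) atTop
      (𝓝 (CFC.sqrt (p.π a))) := by
    intro p
    rw [tendsto_iff_norm_sub_tendsto_zero]
    refine squeeze_zero' (Eventually.of_forall fun n => norm_nonneg _) ?_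
      tendsto_one_div_add_atTop_nhds_zero_nat
    filter_upwards [eventually_ge_atTop ⌈p a⌉₊] with n hn
    exact key p n ((Nat.le_ceil _).trans (by exact_mod_cast hn))
  have hcauchy : CauchySeq b := by
    rw [cauchySeq_iff_tendsto, uniformity_eq_comap_nhds_zero, tendsto_comap_iff,
      LocallyCStarAlgebra.withSeminorms.tendsto_nhds]
    intro p ε hε
    have h1 := cauchySeq_iff_tendsto.1 (htends p).cauchySeq
    rw [uniformity_eq_comap_nhds_zero, tendsto_comap_iff, tendsto_zero_iff_norm_tendsto_zero] at h1
    filter_upwards [h1.eventually (gt_mem_nhds hε)] with x hx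
    simp only [Function.comp_apply, Prod.map] at hx ⊢
    rwa [← map_sub, p.norm_π, ← p.coe_toSeminorm, ← sub_zero (b x.2 - b x.1)] at hx
  obtain ⟨c, hc⟩ := cauchySeq_tendsto_of_complete hcauchy
  refine ⟨c, sub_eq_zero.1 (eq_zero_of_forall _ fun p => ?_)⟩
  have h1 : p.π c = CFC.sqrt (p.π a) :=
    tendsto_nhds_unique ((p.continuous_π.tendsto c).comp hc) (htends p)
  rw [← p.norm_π, map_sub, map_mul, map_star, h1,
    (IsSelfAdjoint.of_nonneg (CFC.sqrt_nonneg (p.π a))).star_eq, CFC.sqrt_mul_sqrt_self _ (h p),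
    sub_self, norm_zero]

end Algebra

/-- A right `B`-module with a `B`-valued semi-inner product, linear in the second variable: a
pre-Hilbert module without the requirement that `⟨x, x⟩ = 0` only for `x = 0`. The right action
`x b` is `act x b`. -/
class SemiHilbertModule (B E : Type*) [LocallyCStarAlgebra B] [AddCommGroup E] [Module ℂ E] where
  act : E →ₗ[ℂ] B →ₗ[ℂ] E
  act_act : ∀ (x : E) (a b : B), act (act x a) b = act x (a * b)
  ip (B) : E → E → B
  ip_add_right : ∀ x y z : E, ip x (y + z) = ip x y + ip x z
  ip_smul_right : ∀ (c : ℂ) (x y : E), ip x (c • y) = c • ip x y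
  ip_act_right : ∀ (x y : E) (b : B), ip x (act y b) = ip x y * b
  star_ip : ∀ x y : E, star (ip x y) = ip y x
  ip_self_pos : ∀ x : E, IsPositive (ip x x)

open SemiHilbertModule (act ip)

section Semi

variable {B E : Type*} [LocallyCStarAlgebra B] [AddCommGroup E] [Module ℂ E]
  [SemiHilbertModule B E]

open SemiHilbertModule

variable (B) in
lemma ip_add_left (x y z : E) : ip B (x + y) z = ip B x z + ip B y z := by
  rw [← star_ip, ip_add_right, star_add, star_ip, star_ip]

variable (B) in
lemma ip_smul_left (c : ℂ) (x y : E) : ip B (c • x) y = (starRingEnd ℂ c) • ip B x y := by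
  rw [← star_ip, ip_smul_right, star_smul, star_ip]
  rfl

lemma ip_act_left (x y : E) (b : B) : ip B (act x b) y = star b * ip B x y := by
  rw [← star_ip, ip_act_right, star_mul, star_ip]

variable (B) in
/-- The `B`-valued inner product as a sesquilinear map. -/
def ipₛₗ : E →ₗ⋆[ℂ] E →ₗ[ℂ] B :=
  LinearMap.mk₂'ₛₗ (starRingEnd ℂ) (RingHom.id ℂ) (ip B) (ip_add_left B) (ip_smul_left B)
    (ip_add_right) (ip_smul_right)

lemma ipₛₗ_apply (x y : E) : ipₛₗ B x y = ip B x y := rfl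

variable (B) in
lemma ip_zero_left (x : E) : ip B 0 x = 0 := by
  rw [← ipₛₗ_apply, map_zero, LinearMap.zero_apply]

variable (B) in
lemma ip_zero_right (x : E) : ip B x 0 = 0 := by
  rw [← ipₛₗ_apply, map_zero]

variable (B) in
lemma ip_sub_right (x y z : E) : ip B x (y - z) = ip B x y - ip B x z := by
  simp only [← ipₛₗ_apply, map_sub]

variable (B) in
lemma ip_sub_left (x y z : E) : ip B (x - y) z = ip B x z - ip B y z := by
  simp only [← ipₛₗ_apply, map_sub, LinearMap.sub_apply]

variable (B) in
lemma ip_sum_left {ι : Type*} (s : Finset ι) (f : ι → E) (y : E) :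
    ip B (∑ i ∈ s, f i) y = ∑ i ∈ s, ip B (f i) y := by
  simp only [← ipₛₗ_apply, map_sum, LinearMap.sum_apply]

variable (B) in
lemma ip_sum_right {ι : Type*} (s : Finset ι) (f : ι → E) (y : E) :
    ip B y (∑ i ∈ s, f i) = ∑ i ∈ s, ip B y (f i) := by
  simp only [← ipₛₗ_apply, map_sum]

/-- The Cauchy-Schwarz inequality. -/
lemma ip_cauchy_schwarz (p : CStarSeminorm B) (x y : E) :
    p (ip B x y) ^ 2 ≤ p (ip B x x) * p (ip B y y) := by
  have key : ∀ t : ℝ, 0 < t → p (ip B x x) ≤ t → p (ip B x y) ^ 2 ≤ t * p (ip B y y) := by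
    intro t ht hxt
    set a := p.π (ip B x y) with ha
    have h1 := (ip_self_pos (B := B) (act x (ip B x y) - (t : ℂ) • y)).π_nonneg p
    have h2 : p.π (ip B (act x (ip B x y) - (t : ℂ) • y) (act x (ip B x y) - (t : ℂ) • y)) =
        star a * p.π (ip B x x) * a - (t : ℂ) • (star a * a) - (t : ℂ) • (star a * a) +
          (t : ℂ) • (t : ℂ) • p.π (ip B y y) := by
      simp only [ip_sub_left, ip_sub_right, ip_act_left, ip_act_right, ip_smul_left,
        ip_smul_right, map_sub, map_mul, map_smul, map_star, Complex.conj_ofReal, ha]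
      have h3 : p.π (ip B y x) = star (p.π (ip B x y)) := by rw [← map_star, star_ip]
      rw [h3]
      simp only [smul_sub, sub_mul, smul_mul_assoc, mul_assoc]
      abel
    have h3 : star a * p.π (ip B x x) * a ≤ (t : ℂ) • (star a * a) := by
      have h4 : IsSelfAdjoint (p.π (ip B x x)) :=
        .of_nonneg ((ip_self_pos (B := B) x).π_nonneg p)
      refine (CStarAlgebra.star_left_conjugate_le_norm_smul h4).trans ?_
      rw [p.norm_π, Complex.coe_smul]
      exact smul_le_smul_of_nonneg_right hxt (star_mul_self_nonneg a)
    rw [h2] at h1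
    have h4 : (t : ℂ) • (star a * a) ≤ (t : ℂ) • (t : ℂ) • p.π (ip B y y) := by
      rw [← sub_nonneg]
      refine h1.trans ?_
      rw [← sub_nonneg]
      have := sub_nonneg.2 h3
      convert this using 1
      abel
    have h5 : star a * a ≤ t • p.π (ip B y y) := by
      have := smul_le_smul_of_nonneg_left h4 (inv_nonneg.2 ht.le)
      rw [Complex.coe_smul, Complex.coe_smul, Complex.coe_smul, smul_smul, smul_smul,
        inv_mul_cancel₀ ht.ne', one_smul, one_smul] at this
      exact this
    have h6 := CStarAlgebra.norm_le_norm_of_nonneg_of_le (star_mul_self_nonneg a) h5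
    rw [CStarRing.norm_star_mul_self, norm_smul, p.norm_π, p.norm_π, Real.norm_eq_abs,
      abs_of_pos ht] at h6
    rw [sq]
    exact h6
  have h0 : 0 ≤ p (ip B y y) := p.nonneg _
  have h0' : 0 ≤ p (ip B x x) := p.nonneg _
  refine le_of_forall_pos_le_add fun ε hε => ?_
  have h1 : 0 < ε / (p (ip B y y) + 1) := by positivity
  refine (key (p (ip B x x) + ε / (p (ip B y y) + 1)) (by positivity) (by linarith)).trans ?_
  rw [add_mul]
  gcongr
  rw [div_mul_eq_mul_div, div_le_iff₀ (by positivity)]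
  nlinarith

variable (E) in
/-- The seminorm `x ↦ √p(⟨x, x⟩)` on a Hilbert module. -/
def modSeminorm (p : CStarSeminorm B) : Seminorm ℂ E :=
  Seminorm.of (fun x => √(p (ip B x x)))
    (fun x y => by
      rw [Real.sqrt_le_iff]
      refine ⟨by positivity, ?_⟩
      have h1 : p (ip B x y) ≤ √(p (ip B x x)) * √(p (ip B y y)) := by
        rw [← Real.sqrt_mul (p.nonneg _)]
        exact Real.le_sqrt_of_sq_le (ip_cauchy_schwarz p x y)
      have h2 : p (ip B y x) = p (ip B x y) := by rw [← star_ip, p.star]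
      have h3 := Real.sq_sqrt (p.nonneg (ip B x x))
      have h4 := Real.sq_sqrt (p.nonneg (ip B y y))
      have h5 : p (ip B (x + y) (x + y)) ≤
          p (ip B x x) + p (ip B x y) + (p (ip B y x) + p (ip B y y)) := by
        rw [ip_add_left, ip_add_right, ip_add_right]
        exact (p.add_le _ _).trans (add_le_add (p.add_le _ _) (p.add_le _ _))
      nlinarith)
    (fun c x => by
      rw [ip_smul_left, ip_smul_right, p.smul, p.smul, ← mul_assoc, RCLike.norm_conj,
        Real.sqrt_mul (by positivity), Real.sqrt_mul_self (norm_nonneg c)])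

lemma modSeminorm_apply (p : CStarSeminorm B) (x : E) : modSeminorm E p x = √(p (ip B x x)) := rfl

lemma modSeminorm_sq (p : CStarSeminorm B) (x : E) : modSeminorm E p x ^ 2 = p (ip B x x) :=
  Real.sq_sqrt (p.nonneg _)

lemma ip_le (p : CStarSeminorm B) (x y : E) :
    p (ip B x y) ≤ modSeminorm E p x * modSeminorm E p y := by
  rw [modSeminorm_apply, modSeminorm_apply, ← Real.sqrt_mul (p.nonneg _)]
  exact Real.le_sqrt_of_sq_le (ip_cauchy_schwarz p x y)

lemma exists_compression {D : Type*} [NonUnitalCStarAlgebra D] [PartialOrder D]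
    [StarOrderedRing D] (G : D) (hGs : IsSelfAdjoint G) :
    ∃ N Z : D, star N = N ∧ N * G * N = - (star Z * Z) ∧ (Z = 0 → ∃ S, star S * S = G) := by
  set N := G⁻ with hNdef
  have hN0 : 0 ≤ N := CFC.negPart_nonneg G
  have hNs : IsSelfAdjoint N := .of_nonneg hN0
  have hSs : IsSelfAdjoint (CFC.sqrt N) := .of_nonneg (CFC.sqrt_nonneg N)
  have h3 : CFC.sqrt N * CFC.sqrt N = N := CFC.sqrt_mul_sqrt_self N hN0
  refine ⟨N, CFC.sqrt N * N, hNs.star_eq, ?_, fun hZ => ?_⟩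
  · have h1 : G⁺ - N = G := CFC.posPart_sub_negPart G hGs
    have h2 : N * G⁺ = 0 := CFC.negPart_mul_posPart G
    have h4 : star (CFC.sqrt N * N) * (CFC.sqrt N * N) = N * (CFC.sqrt N * CFC.sqrt N) * N := by
      rw [star_mul, hSs.star_eq, hNs.star_eq]
      simp only [mul_assoc]
    rw [h4, h3, show N * G * N = N * (G⁺ - N) * N by rw [h1], mul_sub, h2, zero_sub, neg_mul]
  · have h1 : N * N = 0 := by
      calc N * N = CFC.sqrt N * (CFC.sqrt N * N) := by rw [← mul_assoc, h3]
        _ = 0 := by rw [hZ, mul_zero]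
    have hN : N = 0 := by
      rw [← CStarRing.star_mul_self_eq_zero_iff, hNs.star_eq, h1]
    have hG0 : 0 ≤ G := by
      rw [← CFC.posPart_sub_negPart G hGs, ← hNdef, hN, sub_zero]
      exact CFC.posPart_nonneg G
    refine ⟨CFC.sqrt G, ?_⟩
    rw [(IsSelfAdjoint.of_nonneg (CFC.sqrt_nonneg G)).star_eq, CFC.sqrt_mul_sqrt_self G hG0]

/-- A hermitian matrix over a C*-algebra which is positive as a quadratic form is of the form
`S⋆ S`. -/
lemma exists_matrix_sqrt {C n : Type*} [NonUnitalCStarAlgebra C] [PartialOrder C]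
    [StarOrderedRing C] [Fintype n] (g : n → n → C) (hg : ∀ i j, star (g i j) = g j i)
    (hquad : ∀ c : n → C, 0 ≤ ∑ k, ∑ i, star (c k) * g k i * c i) :
    ∃ S : n → n → C, ∀ i j, g i j = ∑ k, star (S k i) * S k j := by
  classical
  let G : CStarMatrix n n C := CStarMatrix.ofMatrix g
  have hG : ∀ i j, G i j = g i j := fun _ _ => rfl
  have hGs : IsSelfAdjoint G := by
    ext i j
    rw [CStarMatrix.star_apply, hG, hG, hg]
  obtain ⟨N, Z, hNs, hNGN, hS⟩ := exists_compression G hGs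
  have hZ : Z = 0 := by
    have hdiag : ∀ j, ∑ k, star (Z k j) * Z k j = 0 := by
      intro j
      refine le_antisymm ?_ (Finset.sum_nonneg fun k _ => star_mul_self_nonneg _)
      have h1 := hquad fun i => N i j
      have h2 : ∑ k, ∑ i, star (N k j) * g k i * N i j = (N * G * N) j j := by
        simp only [CStarMatrix.mul_apply, Finset.sum_mul, hG]
        rw [Finset.sum_comm]
        refine Finset.sum_congr rfl fun i _ => Finset.sum_congr rfl fun k _ => ?_
        rw [← CStarMatrix.star_apply, hNs]
      rw [h2, hNGN, CStarMatrix.neg_apply, CStarMatrix.mul_apply, neg_nonneg] at h1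
      simpa only [CStarMatrix.star_apply] using h1
    ext k j
    have h3 := (Finset.sum_eq_zero_iff_of_nonneg
      (fun k _ => star_mul_self_nonneg (Z k j))).1 (hdiag j) k (Finset.mem_univ k)
    simpa using CStarRing.star_mul_self_eq_zero_iff _ |>.1 h3
  obtain ⟨S, hS⟩ := hS hZ
  refine ⟨fun i j => S i j, fun i j => ?_⟩
  rw [← hG, ← hS, CStarMatrix.mul_apply]
  simp only [CStarMatrix.star_apply]

/-- Gram matrices are, up to an arbitrarily small error, of the form `Y⋆ Y`. -/
lemma gram_approx (p : CStarSeminorm B) {n : Type*} [Fintype n] (x : n → E) {ε : ℝ} (hε : 0 < ε) :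
    ∃ Y : n → n → B, ∀ i j, p (ip B (x i) (x j) - ∑ k, star (Y k i) * Y k j) < ε := by
  classical
  let G : n → n → p.Quot := fun i j => p.π (ip B (x i) (x j))
  have hG : ∀ i j, G i j = p.π (ip B (x i) (x j)) := fun _ _ => rfl
  have hquad : ∀ c : n → p.Quot, 0 ≤ ∑ k, ∑ i, star (c k) * G k i * c i := by
    intro c
    have hd : DenseRange (Pi.map fun _ : n => p.π) := DenseRange.piMap fun _ => p.denseRange_π
    refine hd.induction_on (p := fun c : n → p.Quot => 0 ≤ ∑ k, ∑ i, star (c k) * G k i * c i) c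
      (IsClosed.preimage (f := fun c : n → p.Quot => ∑ k, ∑ i, star (c k) * G k i * c i)
        (by fun_prop) (CStarAlgebra.isClosed_nonneg (A := p.Quot))) fun b => ?_
    have h1 := (ip_self_pos (B := B) (∑ i, act (x i) (b i))).π_nonneg p
    convert h1 using 1
    simp only [ip_sum_left, ip_sum_right, ip_act_left, ip_act_right, map_sum, map_mul, map_star,
      Pi.map_apply, hG, mul_assoc]
    rw [Finset.sum_comm]
    simp only [Finset.sum_mul, mul_assoc]
  obtain ⟨S, hSS⟩ := exists_matrix_sqrt (fun i j => G i j)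
    (fun i j => by rw [hG, hG, ← map_star, star_ip]) hquad
  let f : (n → n → p.Quot) → n → n → p.Quot := fun Y i j => G i j - ∑ k, star (Y k i) * Y k j
  have hf : Continuous f := by fun_prop
  have hd : DenseRange (Pi.map fun _ : n => (Pi.map fun _ : n => p.π : (n → B) → n → p.Quot)) :=
    DenseRange.piMap fun _ => DenseRange.piMap fun _ => p.denseRange_π
  have hopen : IsOpen {Y | ∀ i j, ‖f Y i j‖ < ε} := by
    simp only [Set.ofPred_forall]
    refine isOpen_iInter_of_finite fun i => isOpen_iInter_of_finite fun j => ?_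
    exact isOpen_lt (by fun_prop) continuous_const
  obtain ⟨Y, hY⟩ := hd.exists_mem_open hopen ⟨S, fun i j => by
    simp only [f]
    rw [← hSS, sub_self, norm_zero]
    exact hε⟩
  refine ⟨Y, fun i j => ?_⟩
  have := hY i j
  rw [← p.norm_π]
  simpa only [f, hG, Pi.map_apply, map_sub, map_sum, map_mul, map_star] using this

end Semi

/-- A Hilbert module over the locally C*-algebra `B`: a right `B`-module with a `B`-valued inner
product, complete for the topology given by the seminorms `x ↦ √p(⟨x, x⟩)`, `p ∈ S(B)`. -/
class HilbertModule (B E : Type*) [LocallyCStarAlgebra B] [AddCommGroup E] [Module ℂ E]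
    [UniformSpace E] [IsUniformAddGroup E] extends SemiHilbertModule B E, CompleteSpace E where
  eq_zero_of_ip_self : ∀ x : E, ip x x = 0 → x = 0
  withSeminorms : WithSeminorms (fun p : CStarSeminorm B => modSeminorm E p)

/-- A Hilbert module is full if the inner products span a dense subspace of the algebra. -/
def IsFull (B E : Type*) [LocallyCStarAlgebra B] [AddCommGroup E] [Module ℂ E]
    [UniformSpace E] [IsUniformAddGroup E] [HilbertModule B E] : Prop :=
  Dense (Submodule.span ℂ {b : B | ∃ x y : E, ip B x y = b} : Set B)

section Adjointable

open SemiHilbertModule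

variable (B E : Type*) [LocallyCStarAlgebra B] [AddCommGroup E] [Module ℂ E]
    [UniformSpace E] [IsUniformAddGroup E] [HilbertModule B E]

/-- The bounded adjointable module maps on a Hilbert module, as an algebra of linear maps. -/
def adjointableSubalgebra : Subalgebra ℂ (Module.End ℂ E) where
  carrier := {T | (∀ (x : E) (b : B), T (act x b) = act (T x) b) ∧
    (∀ p : CStarSeminorm B, ∃ k : ℝ, 0 < k ∧ ∀ x, modSeminorm E p (T x) ≤ k * modSeminorm E p x) ∧
    ∃ S : E →ₗ[ℂ] E, ∀ x y, ip B (T x) y = ip B x (S y)}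
  mul_mem' := by
    rintro T T' ⟨h1, h2, S, h3⟩ ⟨h1', h2', S', h3'⟩
    refine ⟨fun x b => by simp [h1, h1'], fun p => ?_, S' * S, fun x y => by simp [h3, h3']⟩
    obtain ⟨k, hk, hT⟩ := h2 p
    obtain ⟨k', hk', hT'⟩ := h2' p
    refine ⟨k * k', by positivity, fun x => (hT _).trans ?_⟩
    rw [mul_assoc]
    exact mul_le_mul_of_nonneg_left (hT' x) hk.le
  add_mem' := by
    rintro T T' ⟨h1, h2, S, h3⟩ ⟨h1', h2', S', h3'⟩
    refine ⟨fun x b => by simp [h1, h1'], fun p => ?_, S + S', fun x y => by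
      simp [h3, h3', ip_add_left, ip_add_right]⟩
    obtain ⟨k, hk, hT⟩ := h2 p
    obtain ⟨k', hk', hT'⟩ := h2' p
    refine ⟨k + k', by positivity, fun x => (map_add_le_add _ _ _).trans ?_⟩
    rw [add_mul]
    exact add_le_add (hT x) (hT' x)
  algebraMap_mem' := by
    intro c
    refine ⟨fun x b => by simp [Algebra.algebraMap_eq_smul_one], fun p => ⟨‖c‖ + 1, by positivity,
      fun x => ?_⟩, (starRingEnd ℂ c) • 1, fun x y => ?_⟩
    · have := apply_nonneg (modSeminorm E p) x
      simp only [Algebra.algebraMap_eq_smul_one, LinearMap.smul_apply, Module.End.one_apply,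
        map_smul_eq_mul]
      nlinarith
    · simp [Algebra.algebraMap_eq_smul_one, ip_smul_left, ip_smul_right]

/-- The algebra `L_B(E)` of bounded adjointable module maps on the Hilbert `B`-module `E`. -/
def Adjointable : Type _ := adjointableSubalgebra B E

instance : Ring (Adjointable B E) := inferInstanceAs (Ring (adjointableSubalgebra B E))
instance : Algebra ℂ (Adjointable B E) := inferInstanceAs (Algebra ℂ (adjointableSubalgebra B E))

variable {B E}

namespace Adjointable

/-- The linear map underlying an element of `L_B(E)`. -/
def toEnd : Adjointable B E →ₐ[ℂ] Module.End ℂ E := (adjointableSubalgebra B E).val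

instance : CoeFun (Adjointable B E) fun _ => E → E := ⟨fun T => toEnd T⟩

lemma ext {T T' : Adjointable B E} (h : ∀ x, T x = T' x) : T = T' :=
  Subtype.ext (LinearMap.ext h)

@[simp] lemma add_apply (T T' : Adjointable B E) (x : E) : (T + T') x = T x + T' x := rfl
@[simp] lemma mul_apply (T T' : Adjointable B E) (x : E) : (T * T') x = T (T' x) := rfl
@[simp] lemma smul_apply (c : ℂ) (T : Adjointable B E) (x : E) : (c • T) x = c • T x := rfl
@[simp] lemma zero_apply (x : E) : (0 : Adjointable B E) x = 0 := rfl
@[simp] lemma one_apply (x : E) : (1 : Adjointable B E) x = x := rfl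

lemma map_act (T : Adjointable B E) (x : E) (b : B) : T (act x b) = act (T x) b := T.2.1 x b

lemma bounded (T : Adjointable B E) (p : CStarSeminorm B) :
    ∃ k : ℝ, 0 < k ∧ ∀ x, modSeminorm E p (T x) ≤ k * modSeminorm E p x := T.2.2.1 p

variable (B) in
lemma eq_of_ip {x y : E} (h : ∀ z, ip B z x = ip B z y) : x = y := by
  refine sub_eq_zero.1 (HilbertModule.eq_zero_of_ip_self (B := B) _ ?_)
  rw [ip_sub_right, h, sub_self]

instance : Star (Adjointable B E) where
  star T := ⟨T.2.2.2.choose, by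
    have hS : ∀ x y, ip B (T x) y = ip B x (T.2.2.2.choose y) := T.2.2.2.choose_spec
    set S := T.2.2.2.choose
    have hS' : ∀ x y, ip B (S x) y = ip B x (T y) := fun x y => by
      rw [← star_ip, ← hS, star_ip]
    refine ⟨fun x b => eq_of_ip B fun z => ?_, fun p => ?_, toEnd T, hS'⟩
    · rw [← hS, ip_act_right, ip_act_right, hS]
    · obtain ⟨k, hk, hT⟩ := T.bounded p
      refine ⟨k, hk, fun x => ?_⟩
      have h1 : modSeminorm E p (S x) ^ 2 ≤
          (k * modSeminorm E p x) * modSeminorm E p (S x) := by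
        rw [modSeminorm_sq, ← hS]
        refine (ip_le p _ _).trans ?_
        have := mul_le_mul_of_nonneg_right (hT (S x)) (apply_nonneg (modSeminorm E p) x)
        linarith
      by_contra! h
      have h2 := apply_nonneg (modSeminorm E p) x
      have h3 : 0 < modSeminorm E p (S x) := lt_of_le_of_lt (by positivity) h
      nlinarith⟩

lemma ip_left (T : Adjointable B E) (x y : E) : ip B (T x) y = ip B x (star T y) :=
  T.2.2.2.choose_spec x y

lemma ip_right (T : Adjointable B E) (x y : E) : ip B x (T y) = ip B (star T x) y := by
  rw [← star_ip, ip_left, star_ip]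

instance : StarRing (Adjointable B E) where
  star_involutive T := ext fun x => eq_of_ip B fun z => by rw [← ip_left, ← ip_right]
  star_mul S T := ext fun x => eq_of_ip B fun z => by
    rw [← ip_left, mul_apply, mul_apply, ip_left, ip_left]
  star_add S T := ext fun x => eq_of_ip B fun z => by
    rw [← ip_left, add_apply, add_apply, ip_add_left, ip_add_right, ip_left, ip_left]

instance : StarModule ℂ (Adjointable B E) where
  star_smul c T := ext fun x => eq_of_ip B fun z => by
    rw [← ip_left, smul_apply, smul_apply, ip_smul_left, ip_smul_right, ip_left]
    rfl

/-- The set of bounds of `T` with respect to the seminorm of `E` given by `p`. -/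
def bounds (p : CStarSeminorm B) (T : Adjointable B E) : Set ℝ :=
  {k | 0 ≤ k ∧ ∀ x, modSeminorm E p (T x) ≤ k * modSeminorm E p x}

lemma bounds_bddBelow (p : CStarSeminorm B) (T : Adjointable B E) : BddBelow (bounds p T) :=
  ⟨0, fun _ h => h.1⟩

lemma bounds_nonempty (p : CStarSeminorm B) (T : Adjointable B E) : (bounds p T).Nonempty :=
  let ⟨k, hk, h⟩ := T.bounded p
  ⟨k, hk.le, h⟩

lemma le_sInf_bounds (p : CStarSeminorm B) (T : Adjointable B E) (x : E) :
    modSeminorm E p (T x) ≤ sInf (bounds p T) * modSeminorm E p x := by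
  rcases (apply_nonneg (modSeminorm E p) x).eq_or_lt with h | h
  · obtain ⟨k, hk, hT⟩ := T.bounded p
    have := hT x
    rw [← h, mul_zero] at this ⊢
    exact this
  · rw [← div_le_iff₀ h]
    exact le_csInf (bounds_nonempty p T) fun k hk => (div_le_iff₀ h).2 (hk.2 x)

lemma sInf_bounds_nonneg (p : CStarSeminorm B) (T : Adjointable B E) : 0 ≤ sInf (bounds p T) :=
  Real.sInf_nonneg fun _ h => h.1

/-- The seminorm on `L_B(E)` which maps `T` to the operator norm of the map that `T` induces on
`E_p`. -/
def opSeminorm (p : CStarSeminorm B) : Seminorm ℂ (Adjointable B E) :=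
  Seminorm.ofSMulLE (fun T => sInf (bounds p T))
    (le_antisymm (csInf_le (bounds_bddBelow p _) ⟨le_rfl, fun x => by simp⟩)
      (sInf_bounds_nonneg p _))
    (fun S T => csInf_le (bounds_bddBelow p _)
      ⟨add_nonneg (sInf_bounds_nonneg p _) (sInf_bounds_nonneg p _), fun x => by
        rw [add_apply, add_mul]
        exact (map_add_le_add _ _ _).trans (add_le_add (le_sInf_bounds p S x)
          (le_sInf_bounds p T x))⟩)
    (fun c T => csInf_le (bounds_bddBelow p _)
      ⟨mul_nonneg (norm_nonneg c) (sInf_bounds_nonneg p _), fun x => by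
        rw [smul_apply, map_smul_eq_mul, mul_assoc]
        exact mul_le_mul_of_nonneg_left (le_sInf_bounds p T x) (norm_nonneg c)⟩)

lemma le_opSeminorm (p : CStarSeminorm B) (T : Adjointable B E) (x : E) :
    modSeminorm E p (T x) ≤ opSeminorm p T * modSeminorm E p x := le_sInf_bounds p T x

lemma opSeminorm_le (p : CStarSeminorm B) (T : Adjointable B E) {k : ℝ} (hk : 0 ≤ k)
    (h : ∀ x, modSeminorm E p (T x) ≤ k * modSeminorm E p x) : opSeminorm p T ≤ k :=
  csInf_le (bounds_bddBelow p T) ⟨hk, h⟩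

lemma opSeminorm_mul_le (p : CStarSeminorm B) (S T : Adjointable B E) :
    opSeminorm p (S * T) ≤ opSeminorm p S * opSeminorm p T := by
  have h1 := apply_nonneg (opSeminorm (E := E) p) S
  refine opSeminorm_le p _ (mul_nonneg h1 (apply_nonneg _ _)) fun x => ?_
  rw [mul_assoc]
  exact (le_opSeminorm p S (T x)).trans (mul_le_mul_of_nonneg_left (le_opSeminorm p T x) h1)

lemma opSeminorm_sq_le (p : CStarSeminorm B) (T : Adjointable B E) :
    opSeminorm p T ^ 2 ≤ opSeminorm p (star T * T) := by
  have h0 : 0 ≤ opSeminorm p (star T * T) := apply_nonneg _ _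
  rw [← Real.le_sqrt (apply_nonneg _ _) h0]
  refine opSeminorm_le p _ (Real.sqrt_nonneg _) fun x => ?_
  refine (sq_le_sq₀ (apply_nonneg _ _)
    (mul_nonneg (Real.sqrt_nonneg _) (apply_nonneg _ _))).1 ?_
  rw [mul_pow, Real.sq_sqrt h0, modSeminorm_sq, ip_left]
  refine (ip_le p _ _).trans ?_
  have := mul_le_mul_of_nonneg_left (le_opSeminorm p (star T * T) x)
    (apply_nonneg (modSeminorm E p) x)
  rw [mul_apply] at this
  linarith

lemma opSeminorm_le_star (p : CStarSeminorm B) (T : Adjointable B E) :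
    opSeminorm p T ≤ opSeminorm p (star T) := by
  have h1 := (opSeminorm_sq_le p T).trans (opSeminorm_mul_le p _ _)
  have h2 : 0 ≤ opSeminorm p T := apply_nonneg _ _
  have h3 : 0 ≤ opSeminorm p (star T) := apply_nonneg _ _
  by_contra! h
  nlinarith

lemma opSeminorm_star_mul_self (p : CStarSeminorm B) (T : Adjointable B E) :
    opSeminorm p (star T * T) = opSeminorm p T ^ 2 := by
  refine le_antisymm ((opSeminorm_mul_le p _ _).trans ?_) (opSeminorm_sq_le p T)
  have h1 := opSeminorm_le_star p (star T)
  rw [star_star] at h1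
  rw [sq]
  exact mul_le_mul_of_nonneg_right h1 (apply_nonneg _ _)

/-- The topology of `L_B(E)` is given by the operator seminorms. -/
instance : TopologicalSpace (Adjointable B E) :=
  (SeminormFamily.moduleFilterBasis
    (fun p : CStarSeminorm B => opSeminorm (E := E) p)).topology

lemma withSeminorms : WithSeminorms (fun p : CStarSeminorm B => opSeminorm (E := E) p) := ⟨rfl⟩

end Adjointable

end Adjointable

section LeftAction

/-- A continuous `*`-morphism `Ψ : A → L_B(E)`. -/
structure LeftAction (A B E : Type*) [LocallyCStarAlgebra A] [LocallyCStarAlgebra B]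
    [AddCommGroup E] [Module ℂ E] [UniformSpace E] [IsUniformAddGroup E] [HilbertModule B E] where
  hom : A →⋆ₙₐ[ℂ] Adjointable B E
  continuous_hom : Continuous hom

variable {A B E : Type*} [LocallyCStarAlgebra A] [LocallyCStarAlgebra B]
    [AddCommGroup E] [Module ℂ E] [UniformSpace E] [IsUniformAddGroup E] [HilbertModule B E]

/-- `Ψ : A → L_B(E)` is non-degenerate if the vectors `Ψ(a) x` span a dense subspace of `E`. -/
def LeftAction.IsNondegenerate (Ψ : LeftAction A B E) : Prop :=
  Dense (Submodule.span ℂ {y : E | ∃ (a : A) (x : E), Ψ.hom a x = y} : Set E)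

/-- The continuous C*-seminorm on `A` obtained by pulling back an operator seminorm of `L_B(E)`. -/
def LeftAction.pullback (Ψ : LeftAction A B E) (q : CStarSeminorm B) : CStarSeminorm A where
  toSeminorm := (Adjointable.opSeminorm q).comp (Ψ.hom : A →ₗ[ℂ] Adjointable B E)
  mul_le' a b := by
    simp only [Seminorm.comp_apply, LinearMap.coe_coe, map_mul]
    exact Adjointable.opSeminorm_mul_le q _ _
  star_mul_self' a := by
    simp only [Seminorm.comp_apply, LinearMap.coe_coe, map_mul, map_star]
    exact Adjointable.opSeminorm_star_mul_self q _
  continuous' := (Adjointable.withSeminorms.continuous_seminorm q).comp Ψ.continuous_hom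

lemma LeftAction.pullback_apply (Ψ : LeftAction A B E) (q : CStarSeminorm B) (a : A) :
    Ψ.pullback q a = Adjointable.opSeminorm q (Ψ.hom a) := rfl

end LeftAction

section TensorForm

variable {M N P : Type*} [AddCommGroup M] [Module ℂ M] [AddCommGroup N] [Module ℂ N]
  [AddCommGroup P] [Module ℂ P]

/-- The sesquilinear map on `M ⊗ N` given on elementary tensors by
`(x ⊗ h, y ⊗ k) ↦ f x h y k`. -/
def tensorForm (f : M →ₗ⋆[ℂ] N →ₗ⋆[ℂ] M →ₗ[ℂ] N →ₗ[ℂ] P) :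
    M ⊗[ℂ] N →ₗ⋆[ℂ] M ⊗[ℂ] N →ₗ[ℂ] P :=
  TensorProduct.lift (LinearMap.mk₂'ₛₗ (starRingEnd ℂ) (starRingEnd ℂ)
    (fun x h => TensorProduct.lift (f x h))
    (fun x x' h => by ext; simp) (fun c x h => by ext; simp)
    (fun x h h' => by ext; simp) (fun c x h => by ext; simp))

lemma tensorForm_tmul (f : M →ₗ⋆[ℂ] N →ₗ⋆[ℂ] M →ₗ[ℂ] N →ₗ[ℂ] P) (x y : M) (h k : N) :
    tensorForm f (x ⊗ₜ h) (y ⊗ₜ k) = f x h y k := rfl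

end TensorForm

section Ind

open SemiHilbertModule

/-- A representation of the locally C*-algebra `B` on the Hilbert space `H`: a continuous
`*`-morphism `B → B(H)`. -/
structure AlgRep (B H : Type*) [LocallyCStarAlgebra B] [NormedAddCommGroup H]
    [InnerProductSpace ℂ H] [CompleteSpace H] where
  hom : B →⋆ₙₐ[ℂ] (H →L[ℂ] H)
  continuous_hom : Continuous hom

variable {B H : Type*} [LocallyCStarAlgebra B] [NormedAddCommGroup H]
    [InnerProductSpace ℂ H] [CompleteSpace H]

/-- The continuous C*-seminorm `b ↦ ‖φ(b)‖`. -/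
def AlgRep.seminorm (φ : AlgRep B H) : CStarSeminorm B where
  toSeminorm := (normSeminorm ℂ (H →L[ℂ] H)).comp (φ.hom : B →ₗ[ℂ] (H →L[ℂ] H))
  mul_le' a b := by
    simp only [Seminorm.comp_apply, LinearMap.coe_coe, map_mul]
    exact norm_mul_le (φ.hom a) (φ.hom b)
  star_mul_self' a := by
    simp only [Seminorm.comp_apply, LinearMap.coe_coe, map_mul, map_star]
    exact (CStarRing.norm_star_mul_self (x := φ.hom a)).trans (sq _).symm
  continuous' := continuous_norm.comp φ.continuous_hom

lemma AlgRep.seminorm_apply (φ : AlgRep B H) (b : B) : φ.seminorm b = ‖φ.hom b‖ := rfl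

lemma AlgRep.inner_star (φ : AlgRep B H) (b : B) (h k : H) :
    inner ℂ (φ.hom (star b) h) k = inner ℂ h (φ.hom b k) := by
  rw [map_star, ContinuousLinearMap.star_eq_adjoint, ContinuousLinearMap.adjoint_inner_left]

/-- The algebraic tensor product `E ⊗ H`, to be equipped with the semi-inner product given by
`⟨x ⊗ h, y ⊗ k⟩ = ⟨h, φ(⟨x, y⟩) k⟩`. -/
def IndPre (_φ : AlgRep B H) (E : Type*) [AddCommGroup E] [Module ℂ E] : Type _ := E ⊗[ℂ] H

variable (φ : AlgRep B H) (E : Type*) [AddCommGroup E] [Module ℂ E]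

instance : AddCommGroup (IndPre φ E) := inferInstanceAs (AddCommGroup (E ⊗[ℂ] H))
instance : Module ℂ (IndPre φ E) := inferInstanceAs (Module ℂ (E ⊗[ℂ] H))

variable {E} in
/-- The elementary tensor `x ⊗ h`. -/
def IndPre.tmul (x : E) (h : H) : IndPre φ E := x ⊗ₜ h

variable {φ E} in
lemma IndPre.exists_sum (ξ : IndPre φ E) :
    ∃ (n : ℕ) (x : Fin n → E) (h : Fin n → H), ξ = ∑ i, IndPre.tmul φ (x i) (h i) :=
  TensorProduct.exists_sum_tmul_eq ξ

variable [SemiHilbertModule B E]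

/-- The sesquilinear form on `E ⊗ H` with `⟨x ⊗ h, y ⊗ k⟩ = ⟨h, φ(⟨x, y⟩) k⟩`. -/
def IndPre.form : IndPre φ E →ₗ⋆[ℂ] IndPre φ E →ₗ[ℂ] ℂ :=
  tensorForm (LinearMap.mk₂'ₛₗ (starRingEnd ℂ) (starRingEnd ℂ)
    (fun x h => LinearMap.mk₂ ℂ (fun y k => inner ℂ h (φ.hom (ip B x y) k))
      (fun y y' k => by simp [ip_add_right])
      (fun c y k => by simp [ip_smul_right])
      (fun y k k' => by simp)
      (fun c y k => by simp))
    (fun x x' h => by ext; simp [ip_add_left])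
    (fun c x h => by ext; simp [ip_smul_left])
    (fun x h h' => by ext; simp)
    (fun c x h => by ext; simp [mul_comm]))

variable {E} in
lemma IndPre.form_tmul (x y : E) (h k : H) :
    IndPre.form φ E (tmul φ x h) (tmul φ y k) = inner ℂ h (φ.hom (ip B x y) k) := rfl

variable {E} in
lemma IndPre.form_sum {n m : Type*} [Fintype n] [Fintype m] (x : n → E) (h : n → H)
    (y : m → E) (k : m → H) :
    IndPre.form φ E (∑ i, tmul φ (x i) (h i)) (∑ j, tmul φ (y j) (k j)) =
      ∑ i, ∑ j, inner ℂ (h i) (φ.hom (ip B (x i) (y j)) (k j)) := by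
  simp only [map_sum, LinearMap.sum_apply, form_tmul]
  exact Finset.sum_comm

lemma IndPre.form_conj (ξ η : IndPre φ E) :
    (starRingEnd ℂ) (form φ E η ξ) = form φ E ξ η := by
  obtain ⟨n, x, h, rfl⟩ := ξ.exists_sum
  obtain ⟨m, y, k, rfl⟩ := η.exists_sum
  rw [form_sum, form_sum]
  simp only [map_sum]
  rw [Finset.sum_comm]
  refine Finset.sum_congr rfl fun i _ => Finset.sum_congr rfl fun j _ => ?_
  rw [inner_conj_symm, ← φ.inner_star, star_ip]

lemma IndPre.form_nonneg (ξ : IndPre φ E) : 0 ≤ (form φ E ξ ξ).re := by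
  obtain ⟨n, x, h, rfl⟩ := ξ.exists_sum
  rw [form_sum φ]
  refine le_of_forall_pos_le_add fun ε hε => ?_
  set S := ∑ i, ∑ j, ‖h i‖ * ‖h j‖ with hS
  have hS0 : 0 ≤ S := Finset.sum_nonneg fun i _ => Finset.sum_nonneg fun j _ => by positivity
  have hδ : 0 < ε / (S + 1) := by positivity
  obtain ⟨Y, hY⟩ := gram_approx φ.seminorm x hδ
  have h1 : ∑ i, ∑ j, inner ℂ (h i) (φ.hom (ip B (x i) (x j)) (h j)) =
      ∑ i, ∑ j, inner ℂ (h i)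
        (φ.hom (ip B (x i) (x j) - ∑ k, star (Y k i) * Y k j) (h j)) +
      ∑ k, inner ℂ (∑ i, φ.hom (Y k i) (h i)) (∑ j, φ.hom (Y k j) (h j)) := by
    have h2 : ∑ k, inner ℂ (∑ i, φ.hom (Y k i) (h i)) (∑ j, φ.hom (Y k j) (h j)) =
        ∑ i, ∑ j, inner ℂ (h i) (φ.hom (∑ k, star (Y k i) * Y k j) (h j)) := by
      have h3 : ∀ i j, inner ℂ (h i) (φ.hom (∑ k, star (Y k i) * Y k j) (h j)) =
          ∑ k, inner ℂ (φ.hom (Y k i) (h i)) (φ.hom (Y k j) (h j)) := by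
        intro i j
        rw [map_sum, sum_apply, inner_sum]
        refine Finset.sum_congr rfl fun k _ => ?_
        rw [map_mul]
        refine (φ.inner_star (star (Y k i)) (h i) (φ.hom (Y k j) (h j))).symm.trans ?_
        rw [star_star]
      simp only [h3]
      rw [Finset.sum_congr rfl fun i _ => Finset.sum_comm, Finset.sum_comm]
      refine Finset.sum_congr rfl fun k _ => ?_
      rw [sum_inner]
      exact Finset.sum_congr rfl fun i _ => inner_sum _ _ _
    rw [h2, ← Finset.sum_add_distrib]
    refine Finset.sum_congr rfl fun i _ => ?_
    rw [← Finset.sum_add_distrib]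
    refine Finset.sum_congr rfl fun j _ => ?_
    rw [← inner_add_right, ← add_apply, ← map_add, sub_add_cancel]
  have h2 : ‖∑ i, ∑ j, inner ℂ (h i)
      (φ.hom (ip B (x i) (x j) - ∑ k, star (Y k i) * Y k j) (h j))‖ ≤ ε / (S + 1) * S := by
    rw [hS, Finset.mul_sum]
    refine norm_sum_le_of_le _ fun i _ => ?_
    rw [Finset.mul_sum]
    refine norm_sum_le_of_le _ fun j _ => ?_
    refine (norm_inner_le_norm _ _).trans ?_
    have h3 := (ContinuousLinearMap.le_opNorm
      (φ.hom (ip B (x i) (x j) - ∑ k, star (Y k i) * Y k j)) (h j)).trans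
      (mul_le_mul_of_nonneg_right (hY i j).le (norm_nonneg _))
    calc _ ≤ ‖h i‖ * (ε / (S + 1) * ‖h j‖) := mul_le_mul_of_nonneg_left h3 (norm_nonneg _)
      _ = _ := by ring
  have h3 : 0 ≤ (∑ k, inner ℂ (∑ i, φ.hom (Y k i) (h i)) (∑ j, φ.hom (Y k j) (h j))).re := by
    rw [Complex.re_sum]
    exact Finset.sum_nonneg fun k _ => inner_self_nonneg (𝕜 := ℂ)
  have h4 := (abs_le.1 ((Complex.abs_re_le_norm _).trans h2)).1
  have h5 : ε / (S + 1) * S ≤ ε := by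
    rw [div_mul_eq_mul_div, div_le_iff₀ (by positivity)]
    nlinarith
  rw [h1, Complex.add_re]
  linarith

/-- The semi-inner product on `E ⊗ H`. -/
@[reducible] def IndPre.core : PreInnerProductSpace.Core ℂ (IndPre φ E) where
  inner ξ η := form φ E ξ η
  conj_inner_symm ξ η := form_conj φ E ξ η
  re_inner_nonneg ξ := form_nonneg φ E ξ
  add_left ξ η ζ := by simp
  smul_left ξ η c := by simp

instance : SeminormedAddCommGroup (IndPre φ E) :=
  @InnerProductSpace.Core.toSeminormedAddCommGroup ℂ _ _ _ _ (IndPre.core φ E)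

instance : InnerProductSpace ℂ (IndPre φ E) := InnerProductSpace.ofCore (IndPre.core φ E)

/-- The Hilbert space `_E H`: the Hausdorff completion of `E ⊗ H` for the semi-inner product
`⟨x ⊗ h, y ⊗ k⟩ = ⟨h, φ(⟨x, y⟩) k⟩`. -/
abbrev IndSpace : Type _ := UniformSpace.Completion (IndPre φ E)

variable {E} in
/-- The class of the elementary tensor `x ⊗ h` in `_E H`. -/
def IndSpace.tmul (x : E) (h : H) : IndSpace φ E := (IndPre.tmul φ x h : IndPre φ E)

variable {E} in
lemma IndPre.inner_tmul (x y : E) (h k : H) :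
    inner ℂ (tmul φ x h) (tmul φ y k) = inner ℂ h (φ.hom (ip B x y) k) := rfl

variable {E} in
lemma IndSpace.inner_tmul (x y : E) (h k : H) :
    inner ℂ (tmul φ x h) (tmul φ y k) = inner ℂ h (φ.hom (ip B x y) k) := by
  rw [tmul, tmul, UniformSpace.Completion.inner_coe, IndPre.inner_tmul]

end Ind

section OpTensor

open SemiHilbertModule UniformSpace

variable {B H E : Type*} [LocallyCStarAlgebra B] [NormedAddCommGroup H]
  [InnerProductSpace ℂ H] [CompleteSpace H] [AddCommGroup E] [Module ℂ E] [UniformSpace E]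
  [IsUniformAddGroup E] [HilbertModule B E] (φ : AlgRep B H)

/-- The map `T ⊗ 1` on `E ⊗ H`, for a linear map `T` of `E`. -/
def IndPre.map : Module.End ℂ E →ₐ[ℂ] Module.End ℂ (IndPre φ E) :=
  Module.End.rTensorAlgHom ℂ E H

lemma IndPre.map_tmul (T : Module.End ℂ E) (x : E) (h : H) :
    map φ T (tmul φ x h) = tmul φ (T x) h := rfl

lemma IndPre.inner_map_left (T : Adjointable B E) (ξ η : IndPre φ E) :
    inner ℂ (map φ T.toEnd ξ) η = inner ℂ ξ (map φ (star T).toEnd η) := by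
  obtain ⟨n, x, h, rfl⟩ := ξ.exists_sum
  obtain ⟨m, y, k, rfl⟩ := η.exists_sum
  simp only [map_sum, map_tmul, sum_inner, inner_sum, inner_tmul, Adjointable.ip_left]

lemma IndPre.norm_tmul_le (x : E) (h : H) :
    ‖tmul φ x h‖ ≤ modSeminorm E φ.seminorm x * ‖h‖ := by
  refine (sq_le_sq₀ (norm_nonneg _) (mul_nonneg (apply_nonneg _ _) (norm_nonneg _))).1 ?_
  rw [mul_pow, modSeminorm_sq, ← inner_self_eq_norm_sq (𝕜 := ℂ), inner_tmul, AlgRep.seminorm_apply]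
  refine (RCLike.re_le_norm _).trans ((norm_inner_le_norm _ _).trans ?_)
  have := mul_le_mul_of_nonneg_left ((φ.hom (ip B x x)).le_opNorm h) (norm_nonneg h)
  linarith

lemma IndPre.exists_norm_map_le (ξ : IndPre φ E) :
    ∃ K : ℝ, 0 ≤ K ∧ ∀ T : Adjointable B E,
      ‖map φ T.toEnd ξ‖ ≤ K * Adjointable.opSeminorm φ.seminorm T := by
  obtain ⟨n, x, h, rfl⟩ := ξ.exists_sum
  refine ⟨∑ i, modSeminorm E φ.seminorm (x i) * ‖h i‖,
    Finset.sum_nonneg fun i _ => mul_nonneg (apply_nonneg _ _) (norm_nonneg _), fun T => ?_⟩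
  rw [map_sum, Finset.sum_mul]
  refine norm_sum_le_of_le _ fun i _ => ?_
  rw [map_tmul]
  refine (norm_tmul_le φ _ _).trans ?_
  have := mul_le_mul_of_nonneg_right (Adjointable.le_opSeminorm φ.seminorm T (x i))
    (norm_nonneg (h i))
  linarith

lemma IndPre.norm_map_pow_le (T : Adjointable B E) (hT : star T = T) (ξ : IndPre φ E) (n : ℕ) :
    ‖map φ T.toEnd ξ‖ ^ (2 ^ n) ≤ ‖map φ (T ^ (2 ^ n)).toEnd ξ‖ * ‖ξ‖ ^ (2 ^ n - 1) := by
  induction n with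
  | zero => simp
  | succ n ih =>
    have h1 : ‖map φ (T ^ (2 ^ n)).toEnd ξ‖ ^ 2 ≤ ‖map φ (T ^ (2 ^ (n + 1))).toEnd ξ‖ * ‖ξ‖ := by
      rw [← inner_self_eq_norm_sq (𝕜 := ℂ), inner_map_left, star_pow, hT, ← Module.End.mul_apply,
        ← map_mul, ← map_mul, ← pow_add, ← two_mul, ← pow_succ']
      refine (RCLike.re_le_norm _).trans ((norm_inner_le_norm _ _).trans (le_of_eq (mul_comm _ _)))
    calc ‖map φ T.toEnd ξ‖ ^ (2 ^ (n + 1)) = (‖map φ T.toEnd ξ‖ ^ (2 ^ n)) ^ 2 := by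
          rw [← pow_mul, pow_succ]
      _ ≤ (‖map φ (T ^ (2 ^ n)).toEnd ξ‖ * ‖ξ‖ ^ (2 ^ n - 1)) ^ 2 := by gcongr
      _ = ‖map φ (T ^ (2 ^ n)).toEnd ξ‖ ^ 2 * ‖ξ‖ ^ (2 * (2 ^ n - 1)) := by
          rw [mul_pow, ← pow_mul, mul_comm 2]
      _ ≤ (‖map φ (T ^ (2 ^ (n + 1))).toEnd ξ‖ * ‖ξ‖) * ‖ξ‖ ^ (2 * (2 ^ n - 1)) := by gcongr
      _ = _ := by
          rw [mul_assoc, ← pow_succ']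
          congr 2
          have := Nat.one_le_two_pow (n := n)
          omega

lemma IndPre.opSeminorm_pow_le (p : CStarSeminorm B) (T : Adjointable B E) (n : ℕ) :
    Adjointable.opSeminorm p (T ^ (n + 1)) ≤ Adjointable.opSeminorm p T ^ (n + 1) := by
  induction n with
  | zero => simp
  | succ n ih =>
    rw [pow_succ, pow_succ _ (n + 1)]
    exact (Adjointable.opSeminorm_mul_le p _ _).trans
      (mul_le_mul_of_nonneg_right ih (apply_nonneg _ _))

lemma IndPre.norm_map_le_of_star (T : Adjointable B E) (hT : star T = T) (ξ : IndPre φ E) :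
    ‖map φ T.toEnd ξ‖ ≤ Adjointable.opSeminorm φ.seminorm T * ‖ξ‖ := by
  set c := Adjointable.opSeminorm φ.seminorm T with hc
  have hc0 : 0 ≤ c := apply_nonneg _ _
  obtain ⟨K, hK, hb⟩ := exists_norm_map_le φ ξ
  have key : ∀ n : ℕ, ‖map φ T.toEnd ξ‖ ^ (2 ^ n) ≤ (K * c ^ (2 ^ n)) * ‖ξ‖ ^ (2 ^ n - 1) := by
    intro n
    refine (norm_map_pow_le φ T hT ξ n).trans ?_
    gcongr
    refine (hb _).trans ?_
    obtain ⟨m, hm⟩ : ∃ m, 2 ^ n = m + 1 := ⟨2 ^ n - 1, by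
      have := Nat.one_le_two_pow (n := n)
      omega⟩
    rw [hm]
    exact mul_le_mul_of_nonneg_left (opSeminorm_pow_le _ _ _) hK
  rcases (norm_nonneg ξ).eq_or_lt with h0 | h0
  · have h1 := key 1
    rw [← h0] at h1 ⊢
    have h2 : ‖map φ T.toEnd ξ‖ ^ 2 ≤ 0 := by simpa using h1
    have h3 := norm_nonneg (map φ T.toEnd ξ)
    nlinarith
  · by_contra! hlt
    have hpos : 0 < ‖map φ T.toEnd ξ‖ := lt_of_le_of_lt (by positivity) hlt
    rcases hc0.eq_or_lt with hc1 | hc1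
    · have h1 := key 0
      rw [← hc1, pow_zero, pow_one, pow_one, mul_zero, zero_mul] at h1
      linarith
    · set r := ‖map φ T.toEnd ξ‖ / (c * ‖ξ‖) with hr
      have hr1 : 1 < r := (one_lt_div (by positivity)).2 hlt
      have h2 : ∀ n : ℕ, r ^ (2 ^ n) ≤ K / ‖ξ‖ := by
        intro n
        rw [hr, div_pow, div_le_div_iff₀ (by positivity) h0, mul_pow]
        have h3 := mul_le_mul_of_nonneg_right (key n) h0.le
        refine h3.trans (le_of_eq ?_)
        have h4 : ‖ξ‖ ^ (2 ^ n) = ‖ξ‖ ^ (2 ^ n - 1) * ‖ξ‖ := by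
          rw [← pow_succ]
          congr 1
          have := Nat.one_le_two_pow (n := n)
          omega
        rw [h4]
        ring
      obtain ⟨n, hn⟩ := pow_unbounded_of_one_lt (K / ‖ξ‖) hr1
      have h3 := h2 n
      have h4 : r ^ n ≤ r ^ (2 ^ n) := pow_le_pow_right₀ hr1.le (Nat.lt_two_pow_self).le
      linarith

lemma IndPre.norm_map_le (T : Adjointable B E) (ξ : IndPre φ E) :
    ‖map φ T.toEnd ξ‖ ≤ Adjointable.opSeminorm φ.seminorm T * ‖ξ‖ := by
  refine (sq_le_sq₀ (norm_nonneg _) (mul_nonneg (apply_nonneg _ _) (norm_nonneg _))).1 ?_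
  rw [mul_pow, ← Adjointable.opSeminorm_star_mul_self, ← inner_self_eq_norm_sq (𝕜 := ℂ),
    inner_map_left, ← Module.End.mul_apply, ← map_mul, ← map_mul]
  refine (RCLike.re_le_norm _).trans ((norm_inner_le_norm _ _).trans ?_)
  have := mul_le_mul_of_nonneg_left (norm_map_le_of_star φ (star T * T) (by simp) ξ)
    (norm_nonneg ξ)
  linarith

/-- The bounded operator `T ⊗ 1` on `_E H`, for `T` in `L_B(E)`. -/
def IndSpace.map (T : Adjointable B E) : IndSpace φ E →L[ℂ] IndSpace φ E :=
  ((IndPre.map φ T.toEnd).mkContinuous _ (IndPre.norm_map_le φ T)).completion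

lemma IndSpace.map_coe (T : Adjointable B E) (ξ : IndPre φ E) :
    map φ T (ξ : IndSpace φ E) = (IndPre.map φ T.toEnd ξ : IndPre φ E) :=
  ContinuousLinearMap.completion_apply_coe _ ξ

lemma IndSpace.map_tmul (T : Adjointable B E) (x : E) (h : H) :
    map φ T (tmul φ x h) = tmul φ (T x) h := map_coe φ T _

lemma IndSpace.ext_coe {F : Type*} [TopologicalSpace F] [AddCommGroup F] [Module ℂ F] [T2Space F]
    {f g : IndSpace φ E →L[ℂ] F} (h : ∀ ξ : IndPre φ E, f ξ = g ξ) : f = g :=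
  ContinuousLinearMap.ext fun ξ => Completion.induction_on ξ
    (isClosed_eq f.continuous g.continuous) h

lemma IndSpace.norm_map_le (T : Adjointable B E) :
    ‖map φ T‖ ≤ Adjointable.opSeminorm φ.seminorm T := by
  refine ContinuousLinearMap.opNorm_le_bound _ (apply_nonneg _ _) fun ξ => ?_
  refine Completion.induction_on ξ (isClosed_le (by fun_prop) (by fun_prop)) fun ξ => ?_
  rw [map_coe, Completion.norm_coe, Completion.norm_coe]
  exact IndPre.norm_map_le φ T ξ

/-- The `*`-morphism `T ↦ T ⊗ 1` from `L_B(E)` to `B(_E H)`. -/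
def IndSpace.mapHom : Adjointable B E →⋆ₙₐ[ℂ] (IndSpace φ E →L[ℂ] IndSpace φ E) where
  toFun T := map φ T
  map_smul' c T := ext_coe φ fun ξ => by
    rw [map_coe, map_smul, map_smul]
    simp [map_coe, Completion.coe_smul]
  map_zero' := ext_coe φ fun ξ => by
    rw [map_coe, map_zero, map_zero]
    simp [Completion.coe_zero]
  map_add' S T := ext_coe φ fun ξ => by
    rw [map_coe, map_add, map_add]
    simp [map_coe, Completion.coe_add]
  map_mul' S T := ext_coe φ fun ξ => by
    rw [map_coe, map_mul, map_mul]
    simp [map_coe]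
  map_star' T := by
    rw [ContinuousLinearMap.star_eq_adjoint, ContinuousLinearMap.eq_adjoint_iff]
    intro ξ η
    refine Completion.induction_on₂ ξ η (isClosed_eq (by fun_prop) (by fun_prop)) fun ξ η => ?_
    rw [map_coe, map_coe, Completion.inner_coe, Completion.inner_coe, IndPre.inner_map_left,
      star_star]

variable {A : Type*} [LocallyCStarAlgebra A]

/-- The Rieffel induced representation `a ↦ Ψ(a) ⊗ 1` of `A` on `_E H`. -/
def inducedAlgRep (Ψ : LeftAction A B E) : AlgRep A (IndSpace φ E) where
  hom := (IndSpace.mapHom φ).comp Ψ.hom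
  continuous_hom := by
    refine continuous_of_continuousAt_zero ((IndSpace.mapHom φ).comp Ψ.hom) ?_
    rw [ContinuousAt, map_zero, tendsto_zero_iff_norm_tendsto_zero]
    refine squeeze_zero (fun _ => norm_nonneg _) (fun a => IndSpace.norm_map_le φ (Ψ.hom a)) ?_
    exact (Ψ.pullback φ.seminorm).continuous.tendsto' 0 0 (Ψ.pullback φ.seminorm).zero

lemma inducedAlgRep_tmul (Ψ : LeftAction A B E) (a : A) (x : E) (h : H) :
    (inducedAlgRep φ Ψ).hom a (IndSpace.tmul φ x h) = IndSpace.tmul φ (Ψ.hom a x) h :=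
  IndSpace.map_tmul φ _ _ _

end OpTensor

section Completion

open SemiHilbertModule UniformSpace Completion Topology Filter

/-- A copy of the semi-Hilbert module `X`, with the topology given by the seminorms
`x ↦ √p(⟨x, x⟩)`. -/
def SemiTop (B X : Type*) [LocallyCStarAlgebra B] [AddCommGroup X] [Module ℂ X]
    [SemiHilbertModule B X] : Type _ := X

variable (B X : Type*) [LocallyCStarAlgebra B] [AddCommGroup X] [Module ℂ X]
  [SemiHilbertModule B X]

instance : AddCommGroup (SemiTop B X) := inferInstanceAs (AddCommGroup X)
instance : Module ℂ (SemiTop B X) := inferInstanceAs (Module ℂ X)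
instance : SemiHilbertModule B (SemiTop B X) := inferInstanceAs (SemiHilbertModule B X)

instance : TopologicalSpace (SemiTop B X) :=
  (SeminormFamily.moduleFilterBasis
    (fun p : CStarSeminorm B => modSeminorm (SemiTop B X) p)).topology

lemma SemiTop.withSeminorms :
    WithSeminorms (fun p : CStarSeminorm B => modSeminorm (SemiTop B X) p) := ⟨rfl⟩

instance : IsTopologicalAddGroup (SemiTop B X) := (SemiTop.withSeminorms B X).topologicalAddGroup
instance : ContinuousSMul ℂ (SemiTop B X) := (SemiTop.withSeminorms B X).continuousSMul
instance : UniformSpace (SemiTop B X) := IsTopologicalAddGroup.rightUniformSpace _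
instance : IsUniformAddGroup (SemiTop B X) := isUniformAddGroup_of_addCommGroup
instance : UniformContinuousConstSMul ℂ (SemiTop B X) :=
  uniformContinuousConstSMul_of_continuousConstSMul _ _

/-- The Hausdorff completion of a semi-Hilbert module. -/
abbrev HCompletion : Type _ := Completion (SemiTop B X)

variable {B X}

lemma modSeminorm_act_le (p : CStarSeminorm B) (x : X) (b : B) :
    modSeminorm X p (act x b) ≤ p b * modSeminorm X p x := by
  refine (sq_le_sq₀ (apply_nonneg _ _) (mul_nonneg (p.nonneg _) (apply_nonneg _ _))).1 ?_
  rw [mul_pow, modSeminorm_sq, modSeminorm_sq, ip_act_left, ip_act_right]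
  refine (p.mul_le _ _).trans ?_
  rw [p.star]
  have := mul_le_mul_of_nonneg_left (p.mul_le (ip B x x) b) (p.nonneg b)
  nlinarith

/-- The right action of `b` as a continuous linear map. -/
def SemiTop.actL (b : B) : SemiTop B X →L[ℂ] SemiTop B X where
  toLinearMap := (act (B := B) (E := SemiTop B X)).flip b
  cont := by
    refine continuous_of_continuousAt_zero ((act (B := B) (E := SemiTop B X)).flip b) ?_
    rw [ContinuousAt, map_zero, (SemiTop.withSeminorms B X).tendsto_nhds]
    intro p ε hε
    have hm := (SemiTop.withSeminorms B X).continuous_seminorm p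
    have h1 : Tendsto (fun x : SemiTop B X => p b * modSeminorm (SemiTop B X) p x) (𝓝 0) (𝓝 0) :=
      Continuous.tendsto' (by fun_prop) _ _ (by simp)
    filter_upwards [h1.eventually (gt_mem_nhds hε)] with x hx
    rw [sub_zero]
    exact (modSeminorm_act_le p x b).trans_lt hx

lemma SemiTop.actL_apply (b : B) (x : SemiTop B X) : actL b x = act x b := rfl

lemma SemiTop.continuous_ip : Continuous fun x : SemiTop B X × SemiTop B X => ip B x.1 x.2 := by
  rw [continuous_iff_continuousAt]
  rintro ⟨x₀, y₀⟩
  rw [ContinuousAt, LocallyCStarAlgebra.withSeminorms.tendsto_nhds]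
  intro p ε hε
  have hm := (SemiTop.withSeminorms B X).continuous_seminorm p
  have h1 : Tendsto (fun x : SemiTop B X × SemiTop B X =>
      modSeminorm (SemiTop B X) p (x.1 - x₀) * modSeminorm (SemiTop B X) p x.2 +
      modSeminorm (SemiTop B X) p x₀ * modSeminorm (SemiTop B X) p (x.2 - y₀))
      (𝓝 (x₀, y₀)) (𝓝 0) := by
    have : Continuous (fun x : SemiTop B X × SemiTop B X =>
      modSeminorm (SemiTop B X) p (x.1 - x₀) * modSeminorm (SemiTop B X) p x.2 +
      modSeminorm (SemiTop B X) p x₀ * modSeminorm (SemiTop B X) p (x.2 - y₀)) := by fun_prop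
    exact this.tendsto' _ _ (by simp)
  filter_upwards [h1.eventually (gt_mem_nhds hε)] with x hx
  refine lt_of_le_of_lt ?_ hx
  have h2 : ip B x.1 x.2 - ip B x₀ y₀ = ip B (x.1 - x₀) x.2 + ip B x₀ (x.2 - y₀) := by
    rw [ip_sub_left, ip_sub_right, sub_add_sub_cancel]
  rw [h2]
  exact (p.add_le _ _).trans (add_le_add (ip_le p _ _) (ip_le p _ _))

/-- The `B`-valued inner product of the completion. -/
def HCompletion.ip (ξ η : HCompletion B X) : B :=
  (isDenseInducing_coe.prodMap isDenseInducing_coe).extend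
    (fun x : SemiTop B X × SemiTop B X => SemiHilbertModule.ip B x.1 x.2) (ξ, η)

lemma HCompletion.ip_coe (x y : SemiTop B X) :
    HCompletion.ip (x : HCompletion B X) y = SemiHilbertModule.ip B x y :=
  (isDenseInducing_coe.prodMap isDenseInducing_coe).extend_eq SemiTop.continuous_ip (x, y)

lemma HCompletion.continuous_ip :
    Continuous fun x : HCompletion B X × HCompletion B X => HCompletion.ip x.1 x.2 := by
  let m : SemiTop B X →+ SemiTop B X →+ B :=
    { toFun := fun x => (ipₛₗ B x).toAddMonoidHom
      map_zero' := by ext x; exact ip_zero_left B x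
      map_add' := fun x y => by ext z; exact ip_add_left B x y z }
  have h1 : Continuous fun x : SemiTop B X × SemiTop B X => m x.1 x.2 := SemiTop.continuous_ip
  exact (isDenseInducing_toCompl (SemiTop B X)).extend_Z_bilin
    (isDenseInducing_toCompl (SemiTop B X)) h1

lemma HCompletion.continuous_ip_comp {Z : Type*} [TopologicalSpace Z] {f g : Z → HCompletion B X}
    (hf : Continuous f) (hg : Continuous g) : Continuous fun z => HCompletion.ip (f z) (g z) :=
  HCompletion.continuous_ip.comp (hf.prodMk hg)

lemma continuous_mul_right (b : B) : Continuous fun a : B => a * b := by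
  refine continuous_of_continuousAt_zero (AddMonoidHom.mulRight b) ?_
  rw [ContinuousAt, map_zero, LocallyCStarAlgebra.withSeminorms.tendsto_nhds]
  intro p ε hε
  have hm := p.continuous
  have h1 : Tendsto (fun a : B => p a * p b) (𝓝 0) (𝓝 0) :=
    Continuous.tendsto' (by fun_prop) _ _ (by simp [p.zero])
  filter_upwards [h1.eventually (gt_mem_nhds hε)] with a ha
  rw [sub_zero]
  exact (p.mul_le a b).trans_lt ha

lemma continuous_star' : Continuous (star : B → B) := by
  refine continuous_of_continuousAt_zero (starAddEquiv : B ≃+ B) ?_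
  rw [ContinuousAt, map_zero, LocallyCStarAlgebra.withSeminorms.tendsto_nhds]
  intro p ε hε
  have h1 : Tendsto p (𝓝 0) (𝓝 0) := p.continuous.tendsto' _ _ p.zero
  filter_upwards [h1.eventually (gt_mem_nhds hε)] with a ha
  rw [sub_zero]
  exact (p.star a).trans_lt ha

lemma isClosed_isPositive : IsClosed {b : B | IsPositive b} := by
  have : {b : B | IsPositive b} = ⋂ p : CStarSeminorm B, {b | 0 ≤ p.π b} := by
    ext b
    simp only [Set.mem_iInter]
    exact ⟨fun h p => h.π_nonneg p, isPositive_of_forall⟩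
  rw [this]
  exact isClosed_iInter fun p =>
    (CStarAlgebra.isClosed_nonneg (A := p.Quot)).preimage p.continuous_π

/-- The right action of `B` on the completion. -/
def HCompletion.act : HCompletion B X →ₗ[ℂ] B →ₗ[ℂ] HCompletion B X :=
  LinearMap.mk₂ ℂ (fun ξ b => (SemiTop.actL b).completion ξ)
    (fun ξ η b => by simp)
    (fun c ξ b => by simp)
    (fun ξ b b' => Completion.induction_on ξ (isClosed_eq (by fun_prop) (by fun_prop)) fun x => by
      simp only [ContinuousLinearMap.completion_apply_coe, SemiTop.actL_apply, map_add, coe_add])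
    (fun c ξ b => Completion.induction_on ξ
      (isClosed_eq (by fun_prop) (Continuous.const_smul (by fun_prop) c)) fun x => by
      simp only [ContinuousLinearMap.completion_apply_coe, SemiTop.actL_apply, map_smul, coe_smul])

lemma HCompletion.act_coe (x : SemiTop B X) (b : B) :
    HCompletion.act (x : HCompletion B X) b = (SemiHilbertModule.act x b : SemiTop B X) :=
  ContinuousLinearMap.completion_apply_coe _ x

lemma HCompletion.continuous_act (b : B) :
    Continuous fun ξ : HCompletion B X => HCompletion.act ξ b :=
  (SemiTop.actL b).completion.continuous

instance : SemiHilbertModule B (HCompletion B X) where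
  act := HCompletion.act
  act_act ξ a b := Completion.induction_on ξ
    (isClosed_eq ((HCompletion.continuous_act b).comp (HCompletion.continuous_act a))
      (HCompletion.continuous_act _)) fun x => by
    rw [HCompletion.act_coe, HCompletion.act_coe, HCompletion.act_coe, act_act]
  ip := HCompletion.ip
  ip_add_right ξ η ζ := Completion.induction_on₃ ξ η ζ
    (isClosed_eq (HCompletion.continuous_ip_comp (by fun_prop) (by fun_prop))
      ((HCompletion.continuous_ip_comp (by fun_prop) (by fun_prop)).add
        (HCompletion.continuous_ip_comp (by fun_prop) (by fun_prop)))) fun x y z => by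
    rw [← coe_add, HCompletion.ip_coe, HCompletion.ip_coe, HCompletion.ip_coe, ip_add_right]
  ip_smul_right c ξ η := Completion.induction_on₂ ξ η
    (by
      have := LocallyCStarAlgebra.withSeminorms (A := B).continuousSMul
      exact isClosed_eq (HCompletion.continuous_ip_comp (by fun_prop)
        (Continuous.const_smul continuous_snd c))
        (Continuous.const_smul (HCompletion.continuous_ip_comp (by fun_prop) (by fun_prop)) c))
    fun x y => by
    rw [← coe_smul, HCompletion.ip_coe, HCompletion.ip_coe, ip_smul_right]
  ip_act_right ξ η b := Completion.induction_on₂ ξ η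
    (isClosed_eq (HCompletion.continuous_ip_comp continuous_fst
        ((HCompletion.continuous_act b).comp continuous_snd))
      ((continuous_mul_right b).comp
        (HCompletion.continuous_ip_comp continuous_fst continuous_snd)))
    fun x y => by
    rw [HCompletion.act_coe, HCompletion.ip_coe, HCompletion.ip_coe, ip_act_right]
  star_ip ξ η := Completion.induction_on₂ ξ η
    (isClosed_eq (continuous_star'.comp
        (HCompletion.continuous_ip_comp continuous_fst continuous_snd))
      (HCompletion.continuous_ip_comp continuous_snd continuous_fst)) fun x y => by
    rw [HCompletion.ip_coe, HCompletion.ip_coe, star_ip]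
  ip_self_pos ξ := Completion.induction_on ξ
    (isClosed_isPositive.preimage (HCompletion.continuous_ip_comp continuous_id continuous_id))
    fun x => by
      rw [HCompletion.ip_coe]
      exact ip_self_pos x

lemma HCompletion.modSeminorm_coe (p : CStarSeminorm B) (x : SemiTop B X) :
    modSeminorm (HCompletion B X) p x = modSeminorm (SemiTop B X) p x := by
  rw [modSeminorm_apply, modSeminorm_apply]
  exact congrArg (fun b => √(p b)) (HCompletion.ip_coe x x)

lemma HCompletion.continuous_modSeminorm (p : CStarSeminorm B) :
    Continuous (modSeminorm (HCompletion B X) p) :=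
  Real.continuous_sqrt.comp
    (p.continuous.comp (HCompletion.continuous_ip_comp continuous_id continuous_id))

lemma HCompletion.withSeminorms :
    WithSeminorms (fun p : CStarSeminorm B => modSeminorm (HCompletion B X) p) := by
  refine SeminormFamily.withSeminorms_of_nhds _ (le_antisymm ?_ ?_)
  · rw [SeminormFamily.filter_eq_iInf]
    refine le_iInf fun p => ?_
    rw [← tendsto_iff_comap]
    exact (continuous_modSeminorm p).tendsto' 0 0 (map_zero _)
  · intro U hU
    obtain ⟨V, hV, hVc, hVU⟩ := exists_mem_nhds_isClosed_subset hU
    have h1 : (fun x : SemiTop B X => (x : HCompletion B X)) ⁻¹' V ∈ 𝓝 0 :=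
      (Completion.continuous_coe (SemiTop B X)).tendsto' 0 0 coe_zero hV
    obtain ⟨s, r, hr, hs⟩ := ((SemiTop.withSeminorms B X).mem_nhds_iff 0 _).1 h1
    refine mem_of_superset (FilterBasis.mem_filter_of_mem _
      (SeminormFamily.basisSets_mem (fun p : CStarSeminorm B => modSeminorm (HCompletion B X) p)
        s hr)) (Set.Subset.trans ?_ hVU)
    rw [Seminorm.ball_finset_sup_eq_iInter _ _ _ hr]
    set O := ⋂ i ∈ s, (modSeminorm (HCompletion B X) i).ball 0 r with hO
    have hOo : IsOpen O := isOpen_biInter_finset fun i _ => by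
      rw [Seminorm.ball_zero_eq]
      exact isOpen_lt (continuous_modSeminorm i) continuous_const
    have hden : Dense (Set.range fun x : SemiTop B X => (x : HCompletion B X)) := denseRange_coe
    refine (hden.open_subset_closure_inter hOo).trans (hVc.closure_subset_iff.2 ?_)
    rintro _ ⟨hx, x, rfl⟩
    refine hs ?_
    rw [Seminorm.ball_finset_sup_eq_iInter _ _ _ hr]
    simpa only [hO, Set.mem_iInter, Seminorm.mem_ball_zero, modSeminorm_coe] using hx

instance : HilbertModule B (HCompletion B X) where
  eq_zero_of_ip_self ξ h := by
    by_contra hξ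
    obtain ⟨p, hp⟩ := (HCompletion.withSeminorms (B := B) (X := X)).separating_of_T1 ξ hξ
    refine hp ?_
    rw [modSeminorm_apply, h, p.zero, Real.sqrt_zero]
  withSeminorms := HCompletion.withSeminorms

end Completion

section InteriorTensor

open SemiHilbertModule UniformSpace

variable {A B E : Type*} [LocallyCStarAlgebra A] [LocallyCStarAlgebra B]
  [AddCommGroup E] [Module ℂ E] [UniformSpace E] [IsUniformAddGroup E] [HilbertModule B E]

/-- The algebraic tensor product `V ⊗ E`, to be equipped with the `B`-valued semi-inner product
`⟨v ⊗ x, w ⊗ y⟩ = ⟨x, Ψ(⟨v, w⟩) y⟩`. The tensor product is taken over `ℂ`; the elements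
`v a ⊗ x - v ⊗ Ψ(a) x` are null vectors of the semi-inner product, so that they vanish in the
completion. -/
def IntPre (_Ψ : LeftAction A B E) (V : Type*) [AddCommGroup V] [Module ℂ V] : Type _ := V ⊗[ℂ] E

variable (Ψ : LeftAction A B E) (V : Type*) [AddCommGroup V] [Module ℂ V]

instance : AddCommGroup (IntPre Ψ V) := inferInstanceAs (AddCommGroup (V ⊗[ℂ] E))
instance : Module ℂ (IntPre Ψ V) := inferInstanceAs (Module ℂ (V ⊗[ℂ] E))

variable {V} in
/-- The elementary tensor `v ⊗ x`. -/
def IntPre.tmul (v : V) (x : E) : IntPre Ψ V := v ⊗ₜ x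

variable {Ψ V} in
lemma IntPre.exists_sum (ξ : IntPre Ψ V) :
    ∃ (n : ℕ) (v : Fin n → V) (x : Fin n → E), ξ = ∑ i, IntPre.tmul Ψ (v i) (x i) :=
  TensorProduct.exists_sum_tmul_eq ξ

/-- The right action of `B` on `V ⊗ E`, with `(v ⊗ x) b = v ⊗ (x b)`. -/
def IntPre.act : IntPre Ψ V →ₗ[ℂ] B →ₗ[ℂ] IntPre Ψ V :=
  ((LinearMap.lTensorHom V).comp (SemiHilbertModule.act (B := B) (E := E)).flip).flip

variable {V} in
lemma IntPre.act_tmul (v : V) (x : E) (b : B) :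
    IntPre.act Ψ V (tmul Ψ v x) b = tmul Ψ v (SemiHilbertModule.act x b) := rfl

variable [SemiHilbertModule A V]

/-- The `B`-valued sesquilinear form on `V ⊗ E` with `⟨v ⊗ x, w ⊗ y⟩ = ⟨x, Ψ(⟨v, w⟩) y⟩`. -/
def IntPre.form : IntPre Ψ V →ₗ⋆[ℂ] IntPre Ψ V →ₗ[ℂ] B :=
  tensorForm (LinearMap.mk₂'ₛₗ (starRingEnd ℂ) (starRingEnd ℂ)
    (fun v x => LinearMap.mk₂ ℂ (fun w y => ip B x (Ψ.hom (ip A v w) y))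
      (fun w w' y => by simp [ip_add_right])
      (fun c w y => by simp [ip_smul_right])
      (fun w y y' => by simp [ip_add_right])
      (fun c w y => by simp [ip_smul_right]))
    (fun v v' x => by ext; simp [ip_add_left, ip_add_right])
    (fun c v x => by ext; simp [ip_smul_left, ip_smul_right])
    (fun v x x' => by ext; simp [ip_add_left])
    (fun c v x => by ext; simp [ip_smul_left]))

variable {V} in
lemma IntPre.form_tmul (v w : V) (x y : E) :
    IntPre.form Ψ V (tmul Ψ v x) (tmul Ψ w y) = ip B x (Ψ.hom (ip A v w) y) := rfl

variable {V} in
lemma IntPre.form_sum {n m : Type*} [Fintype n] [Fintype m] (v : n → V) (x : n → E)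
    (w : m → V) (y : m → E) :
    IntPre.form Ψ V (∑ i, tmul Ψ (v i) (x i)) (∑ j, tmul Ψ (w j) (y j)) =
      ∑ i, ∑ j, ip B (x i) (Ψ.hom (ip A (v i) (w j)) (y j)) := by
  simp only [map_sum, LinearMap.sum_apply, form_tmul]
  exact Finset.sum_comm

lemma IntPre.form_pos (ξ : IntPre Ψ V) : IsPositive (form Ψ V ξ ξ) := by
  obtain ⟨n, v, x, rfl⟩ := ξ.exists_sum
  rw [form_sum Ψ]
  refine isPositive_of_forall fun q => ?_
  suffices h : q.π (∑ i, ∑ j, ip B (x i) (Ψ.hom (ip A (v i) (v j)) (x j))) ∈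
      closure {c : q.Quot | 0 ≤ c} by
    rwa [(CStarAlgebra.isClosed_nonneg (A := q.Quot)).closure_eq] at h
  rw [Metric.mem_closure_iff]
  intro ε hε
  set S := ∑ i, ∑ j, modSeminorm E q (x i) * modSeminorm E q (x j) with hS
  have hS0 : 0 ≤ S := Finset.sum_nonneg fun i _ => Finset.sum_nonneg fun j _ =>
    mul_nonneg (apply_nonneg _ _) (apply_nonneg _ _)
  have hδ : 0 < ε / (S + 1) := by positivity
  obtain ⟨Y, hY⟩ := gram_approx (Ψ.pullback q) v hδ
  set z : Fin n → E := fun k => ∑ i, Ψ.hom (Y k i) (x i) with hz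
  refine ⟨q.π (∑ k, ip B (z k) (z k)), ?_, ?_⟩
  · rw [map_sum]
    exact Finset.sum_nonneg fun k _ => (ip_self_pos (z k)).π_nonneg q
  have h2 : ∑ k, ip B (z k) (z k) =
      ∑ i, ∑ j, ip B (x i) (Ψ.hom (∑ k, star (Y k i) * Y k j) (x j)) := by
    have h3 : ∀ i j, ip B (x i) (Ψ.hom (∑ k, star (Y k i) * Y k j) (x j)) =
        ∑ k, ip B (Ψ.hom (Y k i) (x i)) (Ψ.hom (Y k j) (x j)) := by
      intro i j
      rw [map_sum, map_sum, LinearMap.sum_apply, ip_sum_right]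
      refine Finset.sum_congr rfl fun k _ => ?_
      rw [map_mul, map_star, Adjointable.mul_apply, Adjointable.ip_left]
    simp only [h3]
    rw [Finset.sum_congr rfl fun i _ => Finset.sum_comm, Finset.sum_comm]
    refine Finset.sum_congr rfl fun k _ => ?_
    rw [hz, ip_sum_left]
    exact Finset.sum_congr rfl fun i _ => ip_sum_right B _ _ _
  have h4 : ∑ i, ∑ j, ip B (x i) (Ψ.hom (ip A (v i) (v j)) (x j)) - ∑ k, ip B (z k) (z k) =
      ∑ i, ∑ j, ip B (x i)
        (Ψ.hom (ip A (v i) (v j) - ∑ k, star (Y k i) * Y k j) (x j)) := by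
    rw [h2, ← Finset.sum_sub_distrib]
    refine Finset.sum_congr rfl fun i _ => ?_
    rw [← Finset.sum_sub_distrib]
    refine Finset.sum_congr rfl fun j _ => ?_
    rw [← ip_sub_right, map_sub, map_sub, LinearMap.sub_apply]
  rw [dist_eq_norm, ← map_sub, q.norm_π, h4]
  have h5 : q (∑ i, ∑ j, ip B (x i)
      (Ψ.hom (ip A (v i) (v j) - ∑ k, star (Y k i) * Y k j) (x j))) ≤ ε / (S + 1) * S := by
    rw [hS, Finset.mul_sum]
    refine (q.sum_le _ _).trans (Finset.sum_le_sum fun i _ => ?_)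
    rw [Finset.mul_sum]
    refine (q.sum_le _ _).trans (Finset.sum_le_sum fun j _ => ?_)
    refine (ip_le q _ _).trans ?_
    have h6 := (Adjointable.le_opSeminorm q
      (Ψ.hom (ip A (v i) (v j) - ∑ k, star (Y k i) * Y k j)) (x j)).trans
      (mul_le_mul_of_nonneg_right (hY i j).le (apply_nonneg (modSeminorm E q) (x j)))
    refine (mul_le_mul_of_nonneg_left h6 (apply_nonneg (modSeminorm E q) (x i))).trans
      (le_of_eq ?_)
    ring
  refine h5.trans_lt ?_
  rw [div_mul_eq_mul_div, div_lt_iff₀ (by positivity)]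
  nlinarith

instance : SemiHilbertModule B (IntPre Ψ V) where
  act := IntPre.act Ψ V
  act_act ξ a b := by
    obtain ⟨n, v, x, rfl⟩ := ξ.exists_sum
    simp only [map_sum, LinearMap.sum_apply, IntPre.act_tmul, act_act]
  ip ξ η := IntPre.form Ψ V ξ η
  ip_add_right ξ η ζ := map_add _ _ _
  ip_smul_right c ξ η := map_smul _ _ _
  ip_act_right ξ η b := by
    obtain ⟨n, v, x, rfl⟩ := ξ.exists_sum
    obtain ⟨m, w, y, rfl⟩ := η.exists_sum
    simp only [map_sum, LinearMap.sum_apply, IntPre.act_tmul, IntPre.form_tmul,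
      Adjointable.map_act, ip_act_right, Finset.sum_mul]
  star_ip ξ η := by
    obtain ⟨n, v, x, rfl⟩ := ξ.exists_sum
    obtain ⟨m, w, y, rfl⟩ := η.exists_sum
    rw [IntPre.form_sum, IntPre.form_sum]
    simp only [star_sum]
    rw [Finset.sum_comm]
    refine Finset.sum_congr rfl fun j _ => Finset.sum_congr rfl fun i _ => ?_
    rw [star_ip, ← star_ip (w j) (v i), map_star, Adjointable.ip_left, star_star]
  ip_self_pos ξ := IntPre.form_pos Ψ V ξ

/-- The interior tensor product `V ⊗_Ψ E`, a Hilbert `B`-module: the Hausdorff completion of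
`V ⊗ E` for the `B`-valued semi-inner product `⟨v ⊗ x, w ⊗ y⟩ = ⟨x, Ψ(⟨v, w⟩) y⟩`. -/
abbrev InteriorTensor : Type _ := HCompletion B (IntPre Ψ V)

variable {V} in
/-- The class of `v ⊗ x` in `V ⊗_Ψ E`, as a linear function of `x`. -/
def InteriorTensor.mk (v : V) : E →ₗ[ℂ] InteriorTensor Ψ V where
  toFun x := ((show SemiTop B (IntPre Ψ V) from IntPre.tmul Ψ v x) : InteriorTensor Ψ V)
  map_add' x y := (congrArg ((↑) : SemiTop B (IntPre Ψ V) → InteriorTensor Ψ V)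
    (TensorProduct.tmul_add v x y)).trans (Completion.coe_add (α := SemiTop B (IntPre Ψ V)) _ _)
  map_smul' c x := (congrArg ((↑) : SemiTop B (IntPre Ψ V) → InteriorTensor Ψ V)
    (TensorProduct.tmul_smul c v x)).trans (Completion.coe_smul (X := SemiTop B (IntPre Ψ V)) c _)

variable {V} in
lemma InteriorTensor.ip_mk (v w : V) (x y : E) :
    ip B (mk Ψ v x) (mk Ψ w y) = ip B x (Ψ.hom (ip A v w) y) :=
  HCompletion.ip_coe (B := B) (X := IntPre Ψ V) (IntPre.tmul Ψ v x) (IntPre.tmul Ψ w y)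

end InteriorTensor

section Representations

open SemiHilbertModule UniformSpace

/-- A representation of the Hilbert `B`-module `W` on the pair of Hilbert spaces `H`, `K`: a map
`Φ : W → B(H, K)` together with a representation `φ : B → B(H)` such that
`Φ(x)⋆ Φ(y) = φ(⟨x, y⟩)`. (Linearity of `Φ` follows.) -/
structure Rep (B W H K : Type*) [LocallyCStarAlgebra B]
    [AddCommGroup W] [Module ℂ W] [UniformSpace W] [IsUniformAddGroup W] [HilbertModule B W]
    [NormedAddCommGroup H] [InnerProductSpace ℂ H] [CompleteSpace H]
    [NormedAddCommGroup K] [InnerProductSpace ℂ K] [CompleteSpace K] where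
  toFun : W → H →L[ℂ] K
  algRep : AlgRep B H
  adjoint_comp : ∀ x y : W,
    (ContinuousLinearMap.adjoint (toFun x)).comp (toFun y) = algRep.hom (ip B x y)

section Def

variable {B W : Type*} [LocallyCStarAlgebra B] [AddCommGroup W] [Module ℂ W] [UniformSpace W]
  [IsUniformAddGroup W] [HilbertModule B W]

/-- Unitary equivalence of representations: there are unitary operators `U₁ : H₁ → H₂` and
`U₂ : K₁ → K₂` with `U₂ Φ₁(w) = Φ₂(w) U₁` for all `w`. -/
def Rep.UnitarilyEquivalent {H₁ K₁ H₂ K₂ : Type*}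
    [NormedAddCommGroup H₁] [InnerProductSpace ℂ H₁] [CompleteSpace H₁]
    [NormedAddCommGroup K₁] [InnerProductSpace ℂ K₁] [CompleteSpace K₁]
    [NormedAddCommGroup H₂] [InnerProductSpace ℂ H₂] [CompleteSpace H₂]
    [NormedAddCommGroup K₂] [InnerProductSpace ℂ K₂] [CompleteSpace K₂]
    (Φ₁ : Rep B W H₁ K₁) (Φ₂ : Rep B W H₂ K₂) : Prop :=
  ∃ (U₁ : H₁ ≃ₗᵢ[ℂ] H₂) (U₂ : K₁ ≃ₗᵢ[ℂ] K₂), ∀ (w : W) (h : H₁),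
    U₂ (Φ₁.toFun w h) = Φ₂.toFun w (U₁ h)

/-- `S` is the direct sum of the representations `Φ i : W → B(H i, K i)`: it acts from the Hilbert
space direct sum of the `H i` to that of the `K i`, and `S(w)` is the operator
`(h i) ↦ (Φ i (w) (h i))`. -/
def Rep.IsDirectSum {I : Type*} {H K : I → Type*}
    [∀ i, NormedAddCommGroup (H i)] [∀ i, InnerProductSpace ℂ (H i)] [∀ i, CompleteSpace (H i)]
    [∀ i, NormedAddCommGroup (K i)] [∀ i, InnerProductSpace ℂ (K i)] [∀ i, CompleteSpace (K i)]
    (S : Rep B W (lp H 2) (lp K 2)) (Φ : ∀ i, Rep B W (H i) (K i)) : Prop :=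
  ∀ (w : W) (h : lp H 2) (i : I), S.toFun w h i = (Φ i).toFun w (h i)

end Def

variable {A B E V H : Type*} [LocallyCStarAlgebra A] [LocallyCStarAlgebra B]
  [AddCommGroup E] [Module ℂ E] [UniformSpace E] [IsUniformAddGroup E] [HilbertModule B E]
  [AddCommGroup V] [Module ℂ V] [UniformSpace V] [IsUniformAddGroup V] [HilbertModule A V]
  [NormedAddCommGroup H] [InnerProductSpace ℂ H] [CompleteSpace H]
  (φ : AlgRep B H) (Ψ : LeftAction A B E)

/-- The map `x ⊗ h ↦ (v ⊗ x) ⊗ h` from `E ⊗ H` to `(V ⊗_Ψ E) ⊗ H`. -/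
def creationPre (v : V) : IndPre φ E →ₗ[ℂ] IndPre φ (InteriorTensor Ψ V) :=
  LinearMap.rTensor H (InteriorTensor.mk Ψ v)

lemma creationPre_tmul (v : V) (x : E) (h : H) :
    creationPre φ Ψ v (IndPre.tmul φ x h) = IndPre.tmul φ (InteriorTensor.mk Ψ v x) h := rfl

lemma creationPre_inner (v w : V) (ξ η : IndPre φ E) :
    inner ℂ (creationPre φ Ψ v ξ) (creationPre φ Ψ w η) =
      inner ℂ ξ (IndPre.map φ (Ψ.hom (ip A v w)).toEnd η) := by
  obtain ⟨n, x, h, rfl⟩ := ξ.exists_sum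
  obtain ⟨m, y, k, rfl⟩ := η.exists_sum
  simp only [map_sum, creationPre_tmul, IndPre.map_tmul, sum_inner, inner_sum, IndPre.inner_tmul,
    InteriorTensor.ip_mk]

lemma creationPre_norm_le (v : V) (ξ : IndPre φ E) :
    ‖creationPre φ Ψ v ξ‖ ≤
      √(Adjointable.opSeminorm φ.seminorm (Ψ.hom (ip A v v))) * ‖ξ‖ := by
  refine (sq_le_sq₀ (norm_nonneg _) (by positivity)).1 ?_
  rw [mul_pow, Real.sq_sqrt (apply_nonneg _ _), ← inner_self_eq_norm_sq (𝕜 := ℂ),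
    creationPre_inner]
  refine (RCLike.re_le_norm _).trans ((norm_inner_le_norm _ _).trans ?_)
  have := mul_le_mul_of_nonneg_left (IndPre.norm_map_le φ (Ψ.hom (ip A v v)) ξ) (norm_nonneg ξ)
  linarith

/-- The bounded operator `x ⊗ h ↦ v ⊗ x ⊗ h` from `_E H` to `_{V ⊗_Ψ E} H`. -/
def creation (v : V) : IndSpace φ E →L[ℂ] IndSpace φ (InteriorTensor Ψ V) :=
  ((creationPre φ Ψ v).mkContinuous _ (creationPre_norm_le φ Ψ v)).completion

lemma creation_coe (v : V) (ξ : IndPre φ E) :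
    creation φ Ψ v (ξ : IndSpace φ E) =
      (creationPre φ Ψ v ξ : IndPre φ (InteriorTensor Ψ V)) :=
  ContinuousLinearMap.completion_apply_coe _ ξ

lemma creation_tmul (v : V) (x : E) (h : H) :
    creation φ Ψ v (IndSpace.tmul φ x h) = IndSpace.tmul φ (InteriorTensor.mk Ψ v x) h :=
  creation_coe φ Ψ v _

variable (V) in
/-- The Rieffel induced representation `v ↦ (x ⊗ h ↦ v ⊗ x ⊗ h)` of `V` via `E`, from `_E H` to
`_{V ⊗_Ψ E} H`, of a representation `Φ` of a Hilbert `B`-module. -/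
def Rep.induced {W K : Type*} [AddCommGroup W] [Module ℂ W] [UniformSpace W]
    [IsUniformAddGroup W] [HilbertModule B W]
    [NormedAddCommGroup K] [InnerProductSpace ℂ K] [CompleteSpace K]
    (Φ : Rep B W H K) (Ψ : LeftAction A B E) :
    Rep A V (IndSpace Φ.algRep E) (IndSpace Φ.algRep (InteriorTensor Ψ V)) where
  toFun v := creation Φ.algRep Ψ v
  algRep := inducedAlgRep Φ.algRep Ψ
  adjoint_comp v w := IndSpace.ext_coe _ fun η => by
    refine ext_inner_left ℂ fun ξ => ?_
    rw [ContinuousLinearMap.comp_apply, ContinuousLinearMap.adjoint_inner_right]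
    refine Completion.induction_on ξ (isClosed_eq (by fun_prop) (by fun_prop)) fun ξ => ?_
    rw [creation_coe, creation_coe, Completion.inner_coe, creationPre_inner]
    refine (Completion.inner_coe _ _).symm.trans (congrArg _ ?_)
    exact (IndSpace.map_coe _ _ _).symm

end Representations

end LCStar

end

/-!
Induction of representations commutes with direct sums, because tensoring does.

A unitary equivalence between `Φ` and the direct sum `S` of the `Φᵢ` contains a unitary operator
`U : H ≃ ⨁ᵢ Hᵢ`. Since `Φ(x)⋆ Φ(y) = φ(⟨x, y⟩)`, it intertwines `φ(b)` with the diagonal operator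
`⨁ᵢ φᵢ(b)` for `b = ⟨x, y⟩`, hence for all `b`, as `W` is full
(`Rep.UnitarilyEquivalent.exists_decomposes`).

For every (semi-)Hilbert `B`-module `F`, the map `x ⊗ h ↦ (x ⊗ (U h)ᵢ)ᵢ` then preserves inner products,
the inner product of `_F H` being built from `φ` alone, and its extension to the completion is a
unitary operator `_F H ≃ ⨁ᵢ _F Hᵢ` (`AlgRep.Decomposes.inducedEquiv`). Its range is closed, and
contains the vectors `x ⊗ h` of each summand, which gives surjectivity.

The unitary operators for `F = E` and `F = V ⊗_Ψ E` carry the induced representation of `Φ` over to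
a representation on the direct sums. On elementary tensors it acts coordinatewise by the induced
representations of the `Φᵢ` (`AlgRep.Decomposes.inducedEquiv_creation`), and so it is their direct
sum; in particular the direct sum exists, the boundedness being inherited from that of `Φ`.
-/

noncomputable section

namespace LCStar

open SemiHilbertModule UniformSpace

/-! ### Intertwining of the algebra representations -/

section Intertwining

variable {B W : Type*} [LocallyCStarAlgebra B] [AddCommGroup W] [Module ℂ W] [UniformSpace W]
  [IsUniformAddGroup W] [HilbertModule B W]

lemma Rep.inner_toFun {H K : Type*}
    [NormedAddCommGroup H] [InnerProductSpace ℂ H] [CompleteSpace H]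
    [NormedAddCommGroup K] [InnerProductSpace ℂ K] [CompleteSpace K]
    (Φ : Rep B W H K) (x y : W) (h k : H) :
    inner ℂ (Φ.toFun x h) (Φ.toFun y k) = inner ℂ h (Φ.algRep.hom (ip B x y) k) := by
  rw [← Φ.adjoint_comp, ContinuousLinearMap.comp_apply, ContinuousLinearMap.adjoint_inner_right]

/-- If the inner products of `W` span a dense subspace, a bounded operator which intertwines two
representations of `B` on them intertwines the representations. -/
lemma IsFull.intertwines (hW : IsFull B W) {H H' : Type*}
    [NormedAddCommGroup H] [InnerProductSpace ℂ H] [CompleteSpace H]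
    [NormedAddCommGroup H'] [InnerProductSpace ℂ H'] [CompleteSpace H']
    (φ : AlgRep B H) (φ' : AlgRep B H') (P : H →L[ℂ] H')
    (hP : ∀ (x y : W) (h : H), P (φ.hom (ip B x y) h) = φ'.hom (ip B x y) (P h))
    (b : B) (h : H) : P (φ.hom b h) = φ'.hom b (P h) := by
  have hc : IsClosed {b : B | P (φ.hom b h) = φ'.hom b (P h)} := by
    have h1 := φ.continuous_hom
    have h2 := φ'.continuous_hom
    exact isClosed_eq (by fun_prop) (by fun_prop)
  refine hW.induction (P := fun b => P (φ.hom b h) = φ'.hom b (P h)) (fun b hb => ?_) hc b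
  induction hb using Submodule.span_induction with
  | mem b hb =>
    obtain ⟨x, y, rfl⟩ := hb
    exact hP x y h
  | zero => simp
  | add a b _ _ ha hb => simp [ha, hb]
  | smul c a _ ha => simp [ha]

variable {H K I : Type*} {Hi Ki : I → Type*}
  [NormedAddCommGroup H] [InnerProductSpace ℂ H] [CompleteSpace H]
  [NormedAddCommGroup K] [InnerProductSpace ℂ K] [CompleteSpace K]
  [∀ i, NormedAddCommGroup (Hi i)] [∀ i, InnerProductSpace ℂ (Hi i)] [∀ i, CompleteSpace (Hi i)]
  [∀ i, NormedAddCommGroup (Ki i)] [∀ i, InnerProductSpace ℂ (Ki i)] [∀ i, CompleteSpace (Ki i)]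

/-- A unitary `U : H ≃ ⨁ᵢ Hᵢ` exhibits the representation `φ` of `B` as the direct sum of the
`φᵢ`: each coordinate of `U` intertwines `φ` with `φᵢ`. -/
def AlgRep.Decomposes (φ : AlgRep B H) (φi : ∀ i, AlgRep B (Hi i)) (U : H ≃ₗᵢ[ℂ] lp Hi 2) : Prop :=
  ∀ (b : B) (h : H) (i : I), U (φ.hom b h) i = (φi i).hom b (U h i)

/-- The representation of `B` associated with a direct sum of representations of a full module
is the direct sum of the associated representations. -/
lemma Rep.IsDirectSum.algRep_apply (hW : IsFull B W) {Φi : ∀ i, Rep B W (Hi i) (Ki i)}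
    {S : Rep B W (lp Hi 2) (lp Ki 2)} (hS : S.IsDirectSum Φi) (b : B) (h : lp Hi 2) (i : I) :
    S.algRep.hom b h i = (Φi i).algRep.hom b (h i) := by
  classical
  refine hW.intertwines S.algRep (Φi i).algRep (lp.evalCLM ℂ Hi 2 i) (fun x y h => ?_) b h
  refine ext_inner_left ℂ fun k => ?_
  have h1 : inner ℂ k (S.algRep.hom (ip B x y) h i) =
      inner ℂ (lp.single 2 i k) (S.algRep.hom (ip B x y) h) :=
    (lp.inner_single_left i k _).symm
  have h2 : S.toFun x (lp.single 2 i k) = lp.single 2 i ((Φi i).toFun x k) := by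
    ext j
    rw [hS]
    obtain rfl | hj := eq_or_ne j i
    · simp
    · rw [lp.single_apply_ne _ _ _ hj, lp.single_apply_ne _ _ _ hj, map_zero]
  refine h1.trans ?_
  rw [← S.inner_toFun, h2, lp.inner_single_left, hS, (Φi i).inner_toFun]
  rfl

/-- The first of the two unitary operators of an equivalence of representations of a full module
also intertwines the associated representations of `B`. -/
lemma Rep.UnitarilyEquivalent.exists_decomposes (hW : IsFull B W) {Φ : Rep B W H K}
    {Φi : ∀ i, Rep B W (Hi i) (Ki i)} {S : Rep B W (lp Hi 2) (lp Ki 2)} (hS : S.IsDirectSum Φi)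
    (hΦ : Φ.UnitarilyEquivalent S) :
    ∃ U : H ≃ₗᵢ[ℂ] lp Hi 2, Φ.algRep.Decomposes (fun i => (Φi i).algRep) U := by
  obtain ⟨U, U', hU⟩ := hΦ
  refine ⟨U, fun b h i => ?_⟩
  rw [← hS.algRep_apply hW]
  refine congrArg (fun f : lp Hi 2 => f i) (hW.intertwines Φ.algRep S.algRep
    (U : H →L[ℂ] lp Hi 2) (fun x y h => ?_) b h)
  refine ext_inner_left ℂ fun k => ?_
  obtain ⟨k, rfl⟩ := U.surjective k
  change inner ℂ (U k) (U (Φ.algRep.hom (ip B x y) h)) =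
    inner ℂ (U k) (S.algRep.hom (ip B x y) (U h))
  rw [U.inner_map_map, ← S.inner_toFun, ← hU, ← hU, U'.inner_map_map, Φ.inner_toFun]

end Intertwining

/-! ### Induced spaces and direct sums -/

section InducedSum

variable {B H I : Type*} {Hi : I → Type*} [LocallyCStarAlgebra B]
  [NormedAddCommGroup H] [InnerProductSpace ℂ H] [CompleteSpace H]
  [∀ i, NormedAddCommGroup (Hi i)] [∀ i, InnerProductSpace ℂ (Hi i)] [∀ i, CompleteSpace (Hi i)]
  {φ : AlgRep B H} {φi : ∀ i, AlgRep B (Hi i)} {U : H ≃ₗᵢ[ℂ] lp Hi 2}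
  (hU : φ.Decomposes φi U)
  (F : Type*) [AddCommGroup F] [Module ℂ F] [SemiHilbertModule B F]

/-- The class of `x ⊗ h` in `_F H`, as a bilinear map. -/
def IndSpace.tmulₗ (φ : AlgRep B H) : F →ₗ[ℂ] H →ₗ[ℂ] IndSpace φ F :=
  (TensorProduct.mk ℂ F H).compr₂
    (Completion.toComplₗᵢ (𝕜 := ℂ) (E := IndPre φ F)).toLinearMap

variable {F} in
lemma IndSpace.tmulₗ_apply (φ : AlgRep B H) (x : F) (h : H) :
    IndSpace.tmulₗ F φ x h = IndSpace.tmul φ x h := rfl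

variable {F} in
lemma IndSpace.coe_sum_tmul (φ : AlgRep B H) {n : Type*} [Fintype n] (x : n → F) (h : n → H) :
    ((∑ j, IndPre.tmul φ (x j) (h j) : IndPre φ F) : IndSpace φ F) =
      ∑ j, IndSpace.tmul φ (x j) (h j) :=
  map_sum (Completion.toCompl (α := IndPre φ F)) _ _

namespace AlgRep.Decomposes

include hU

variable {F} in
/-- The family `(x ⊗ (U h)ᵢ)ᵢ` is square-summable: the squares of its norms are the real parts of
the terms of the series for `⟨U h, U φ(⟨x, x⟩) h⟩`. -/
lemma memℓp_tmul (x : F) (h : H) :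
    Memℓp (fun i => IndSpace.tmul (φi i) x (U h i)) 2 := by
  rw [memℓp_gen_iff (by norm_num)]
  refine (Complex.reCLM.summable (lp.summable_inner (𝕜 := ℂ) (U h) (U (φ.hom (ip B x x) h)))).congr
    fun i => ?_
  simp only [ENNReal.toReal_ofNat, Real.rpow_ofNat]
  rw [← inner_self_eq_norm_sq (𝕜 := ℂ), IndSpace.inner_tmul, hU]
  rfl

/-- The map `x ⊗ h ↦ (x ⊗ (U h)ᵢ)ᵢ` from `F ⊗ H` to `⨁ᵢ _F Hᵢ`. -/
def preMap : IndPre φ F →ₗ[ℂ] lp (fun i => IndSpace (φi i) F) 2 :=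
  TensorProduct.lift (LinearMap.mk₂ ℂ
    (fun x h => ⟨fun i => IndSpace.tmulₗ F (φi i) x (U h i), hU.memℓp_tmul x h⟩)
    (fun x y h => by ext i; simp; rfl)
    (fun c x h => by ext i; simp)
    (fun x h k => by ext i; simp; rfl)
    (fun c x h => by ext i; simp))

variable {F}

lemma preMap_tmul (x : F) (h : H) (i : I) :
    hU.preMap F (IndPre.tmul φ x h) i = IndSpace.tmul (φi i) x (U h i) := rfl

lemma inner_preMap (ξ η : IndPre φ F) :
    inner ℂ (hU.preMap F ξ) (hU.preMap F η) = inner ℂ ξ η := by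
  obtain ⟨n, x, h, rfl⟩ := ξ.exists_sum
  obtain ⟨m, y, k, rfl⟩ := η.exists_sum
  simp only [map_sum, sum_inner, inner_sum]
  refine Finset.sum_congr rfl fun i _ => Finset.sum_congr rfl fun j _ => ?_
  rw [IndPre.inner_tmul, lp.inner_eq_tsum, ← U.inner_map_map, lp.inner_eq_tsum]
  refine tsum_congr fun l => ?_
  rw [preMap_tmul, preMap_tmul, IndSpace.inner_tmul, hU]

/-- The isometry `F ⊗ H → ⨁ᵢ _F Hᵢ`, `x ⊗ h ↦ (x ⊗ (U h)ᵢ)ᵢ`. -/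
def preIsometry (F : Type*) [AddCommGroup F] [Module ℂ F] [SemiHilbertModule B F] :
    IndPre φ F →ₗᵢ[ℂ] lp (fun i => IndSpace (φi i) F) 2 where
  toLinearMap := hU.preMap F
  norm_map' ξ := by
    rw [norm_eq_sqrt_re_inner (𝕜 := ℂ), norm_eq_sqrt_re_inner (𝕜 := ℂ), inner_preMap]

/-- The extension of `preIsometry` to the Hausdorff completion `_F H`. -/
def isometry (F : Type*) [AddCommGroup F] [Module ℂ F] [SemiHilbertModule B F] :
    IndSpace φ F →ₗᵢ[ℂ] lp (fun i => IndSpace (φi i) F) 2 where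
  toLinearMap := (hU.preIsometry F).toContinuousLinearMap.fromCompletion
  norm_map' ξ := Completion.induction_on ξ
    (isClosed_eq (hU.preIsometry F).toContinuousLinearMap.fromCompletion.continuous.norm
      continuous_norm) fun ξ => by
    refine (congrArg norm (ContinuousLinearMap.fromCompletion_apply_coe _ ξ)).trans ?_
    rw [Completion.norm_coe]
    exact (hU.preIsometry F).norm_map ξ

lemma isometry_coe (ξ : IndPre φ F) : hU.isometry F (ξ : IndSpace φ F) = hU.preMap F ξ :=
  ContinuousLinearMap.fromCompletion_apply_coe _ ξ

lemma isometry_surjective : Function.Surjective (hU.isometry F) := by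
  classical
  set R := LinearMap.range (hU.isometry F).toLinearMap with hR
  have hRc : IsClosed (R : Set (lp (fun i => IndSpace (φi i) F) 2)) := by
    rw [hR, LinearMap.coe_range]
    exact (hU.isometry F).isometry.isClosedEmbedding.isClosed_range
  have hsingle : ∀ (i : I) (ξ : IndSpace (φi i) F), lp.single 2 i ξ ∈ R := by
    intro i ξ
    refine Completion.induction_on ξ
      (hRc.preimage (lp.isometry_single (p := 2) i).continuous) fun ξ => ?_
    obtain ⟨n, x, h, rfl⟩ := ξ.exists_sum
    have h1 : lp.single 2 i (∑ j, IndSpace.tmul (φi i) (x j) (h j)) =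
        ∑ j, lp.single (E := fun i => IndSpace (φi i) F) 2 i (IndSpace.tmul (φi i) (x j) (h j)) :=
      map_sum (lp.singleContinuousAddMonoidHom (fun i => IndSpace (φi i) F) 2 i) _ _
    rw [IndSpace.coe_sum_tmul, h1]
    refine R.sum_mem fun j _ => ?_
    -- The vector `x ⊗ h` of the `i`-th summand is the image of `x ⊗ U⋆ (h placed at i)`.
    refine ⟨IndSpace.tmul φ (x j) (U.symm (lp.single 2 i (h j))), ?_⟩
    refine (hU.isometry_coe _).trans ?_
    ext l
    rw [preMap_tmul, U.apply_symm_apply]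
    obtain rfl | hl := eq_or_ne l i
    · simp
    · rw [lp.single_apply_ne _ _ _ hl, lp.single_apply_ne _ _ _ hl]
      rw [← IndSpace.tmulₗ_apply, map_zero]
  intro f
  exact hRc.mem_of_tendsto (lp.hasSum_single (by norm_num) f)
    (Filter.Eventually.of_forall fun s => R.sum_mem fun i _ => hsingle i (f i))

/-- The unitary operator `_F H ≃ ⨁ᵢ _F Hᵢ`, `x ⊗ h ↦ (x ⊗ (U h)ᵢ)ᵢ`: induction along `F` commutes
with direct sums. -/
def inducedEquiv (F : Type*) [AddCommGroup F] [Module ℂ F] [SemiHilbertModule B F] :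
    IndSpace φ F ≃ₗᵢ[ℂ] lp (fun i => IndSpace (φi i) F) 2 :=
  LinearIsometryEquiv.ofSurjective (hU.isometry F) hU.isometry_surjective

lemma inducedEquiv_tmul (x : F) (h : H) (i : I) :
    hU.inducedEquiv F (IndSpace.tmul φ x h) i = IndSpace.tmul (φi i) x (U h i) :=
  congrArg (fun f : lp (fun i => IndSpace (φi i) F) 2 => f i) (hU.isometry_coe _)

end AlgRep.Decomposes

end InducedSum

/-! ### The direct sum of the induced representations -/

section Transport

variable {B W : Type*} [LocallyCStarAlgebra B] [AddCommGroup W] [Module ℂ W] [UniformSpace W]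
  [IsUniformAddGroup W] [HilbertModule B W] {H K H' K' : Type*}
  [NormedAddCommGroup H] [InnerProductSpace ℂ H] [CompleteSpace H]
  [NormedAddCommGroup K] [InnerProductSpace ℂ K] [CompleteSpace K]
  [NormedAddCommGroup H'] [InnerProductSpace ℂ H'] [CompleteSpace H']
  [NormedAddCommGroup K'] [InnerProductSpace ℂ K'] [CompleteSpace K']

/-- The representation `b ↦ U φ(b) U⋆`, for a unitary operator `U`. -/
def AlgRep.conj (φ : AlgRep B H) (U : H ≃ₗᵢ[ℂ] H') : AlgRep B H' where
  hom := U.conjStarAlgEquiv.toNonUnitalStarAlgHom.comp φ.hom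
  continuous_hom := by
    have h1 : Continuous fun b => (U : H →L[ℂ] H') ∘L φ.hom b ∘L (U.symm : H' →L[ℂ] H) :=
      continuous_const.clm_comp (φ.continuous_hom.clm_comp continuous_const)
    exact h1

/-- The representation `w ↦ U' Φ(w) U⋆`, for unitary operators `U` and `U'`. -/
def Rep.conj (Φ : Rep B W H K) (U : H ≃ₗᵢ[ℂ] H') (U' : K ≃ₗᵢ[ℂ] K') : Rep B W H' K' where
  toFun w := (U' : K →L[ℂ] K') ∘L Φ.toFun w ∘L (U.symm : H' →L[ℂ] H)
  algRep := Φ.algRep.conj U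
  adjoint_comp x y := by
    ext h
    refine ext_inner_left ℂ fun k => ?_
    rw [ContinuousLinearMap.comp_apply, ContinuousLinearMap.adjoint_inner_right]
    change inner ℂ (U' (Φ.toFun x (U.symm k))) (U' (Φ.toFun y (U.symm h))) =
      inner ℂ k (U (Φ.algRep.hom (ip B x y) (U.symm h)))
    rw [U'.inner_map_map, Φ.inner_toFun, ← U.inner_map_map, U.apply_symm_apply]

lemma Rep.conj_toFun (Φ : Rep B W H K) (U : H ≃ₗᵢ[ℂ] H') (U' : K ≃ₗᵢ[ℂ] K') (w : W) (h : H') :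
    (Φ.conj U U').toFun w h = U' (Φ.toFun w (U.symm h)) := rfl

lemma Rep.unitarilyEquivalent_conj (Φ : Rep B W H K) (U : H ≃ₗᵢ[ℂ] H') (U' : K ≃ₗᵢ[ℂ] K') :
    Φ.UnitarilyEquivalent (Φ.conj U U') :=
  ⟨U, U', fun w h => by rw [conj_toFun, U.symm_apply_apply]⟩

end Transport

section Creation

variable {A B E V H I : Type*} {Hi : I → Type*} [LocallyCStarAlgebra A] [LocallyCStarAlgebra B]
  [AddCommGroup E] [Module ℂ E] [UniformSpace E] [IsUniformAddGroup E] [HilbertModule B E]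
  [AddCommGroup V] [Module ℂ V] [UniformSpace V] [IsUniformAddGroup V] [HilbertModule A V]
  [NormedAddCommGroup H] [InnerProductSpace ℂ H] [CompleteSpace H]
  [∀ i, NormedAddCommGroup (Hi i)] [∀ i, InnerProductSpace ℂ (Hi i)] [∀ i, CompleteSpace (Hi i)]
  {φ : AlgRep B H} {φi : ∀ i, AlgRep B (Hi i)} {U : H ≃ₗᵢ[ℂ] lp Hi 2}

/-- The unitary operators `_F H ≃ ⨁ᵢ _F Hᵢ`, for `F = E` and for `F = V ⊗_Ψ E`, turn the operator
`x ⊗ h ↦ v ⊗ x ⊗ h` into its coordinatewise version. -/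
lemma AlgRep.Decomposes.inducedEquiv_creation (hU : φ.Decomposes φi U) (Ψ : LeftAction A B E)
    (v : V) (ξ : IndSpace φ E) (i : I) :
    hU.inducedEquiv (InteriorTensor Ψ V) (creation φ Ψ v ξ) i =
      creation (φi i) Ψ v (hU.inducedEquiv E ξ i) := by
  let P := (lp.evalCLM ℂ (fun i => IndSpace (φi i) (InteriorTensor Ψ V)) 2 i) ∘L
    (hU.inducedEquiv (InteriorTensor Ψ V) : IndSpace φ (InteriorTensor Ψ V) →L[ℂ] _) ∘L
      creation φ Ψ v
  let Q := creation (φi i) Ψ v ∘L (lp.evalCLM ℂ (fun i => IndSpace (φi i) E) 2 i) ∘L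
    (hU.inducedEquiv E : IndSpace φ E →L[ℂ] _)
  suffices h : P = Q from DFunLike.congr_fun h ξ
  refine IndSpace.ext_coe φ fun ξ => ?_
  obtain ⟨n, x, h, rfl⟩ := ξ.exists_sum
  rw [IndSpace.coe_sum_tmul, map_sum, map_sum]
  refine Finset.sum_congr rfl fun j _ => ?_
  change hU.inducedEquiv (InteriorTensor Ψ V) (creation φ Ψ v (IndSpace.tmul φ (x j) (h j))) i =
    creation (φi i) Ψ v (hU.inducedEquiv E (IndSpace.tmul φ (x j) (h j)) i)
  rw [creation_tmul, hU.inducedEquiv_tmul, hU.inducedEquiv_tmul, creation_tmul]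

end Creation

end LCStar

end

theorem corollary3p9 {A B V W E H K I : Type*} {Hi Ki : I → Type*}
    [LCStar.LocallyCStarAlgebra A] [LCStar.LocallyCStarAlgebra B]
    [AddCommGroup V] [Module ℂ V] [UniformSpace V] [IsUniformAddGroup V] [LCStar.HilbertModule A V]
    [AddCommGroup W] [Module ℂ W] [UniformSpace W] [IsUniformAddGroup W] [LCStar.HilbertModule B W]
    [AddCommGroup E] [Module ℂ E] [UniformSpace E] [IsUniformAddGroup E] [LCStar.HilbertModule B E]
    [NormedAddCommGroup H] [InnerProductSpace ℂ H] [CompleteSpace H]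
    [NormedAddCommGroup K] [InnerProductSpace ℂ K] [CompleteSpace K]
    [∀ i, NormedAddCommGroup (Hi i)] [∀ i, InnerProductSpace ℂ (Hi i)] [∀ i, CompleteSpace (Hi i)]
    [∀ i, NormedAddCommGroup (Ki i)] [∀ i, InnerProductSpace ℂ (Ki i)] [∀ i, CompleteSpace (Ki i)]
    (hV : LCStar.IsFull A V) (hW : LCStar.IsFull B W)
    (Ψ : LCStar.LeftAction A B E) (hΨ : Ψ.IsNondegenerate)
    (Φ : LCStar.Rep B W H K) (Φi : ∀ i, LCStar.Rep B W (Hi i) (Ki i))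
    (S : LCStar.Rep B W (lp Hi 2) (lp Ki 2)) (hS : S.IsDirectSum Φi)
    (hΦ : Φ.UnitarilyEquivalent S) :
    ∃ T : LCStar.Rep A V (lp (fun i => LCStar.IndSpace (Φi i).algRep E) 2)
        (lp (fun i => LCStar.IndSpace (Φi i).algRep (LCStar.InteriorTensor Ψ V)) 2),
      T.IsDirectSum (fun i => LCStar.Rep.induced V (Φi i) Ψ) ∧
        (LCStar.Rep.induced V Φ Ψ).UnitarilyEquivalent T := by
  obtain ⟨U, hU⟩ := hΦ.exists_decomposes hW hS
  refine ⟨(LCStar.Rep.induced V Φ Ψ).conj (hU.inducedEquiv E)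
    (hU.inducedEquiv (LCStar.InteriorTensor Ψ V)), fun v ξ i => ?_,
    LCStar.Rep.unitarilyEquivalent_conj _ _ _⟩
  rw [LCStar.Rep.conj_toFun]
  refine (hU.inducedEquiv_creation Ψ v _ i).trans ?_
  rw [LinearIsometryEquiv.apply_symm_apply]
  rfl
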